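/- **Setting.** Fix a lattice of squares in $\mathbb{R}^2$ with side length $h_0>0$ and let $\Omega$ be the interior of the union of finitely many closed squares of this lattice. A *cell of level* $\ell\ge 0$ is an open square obtained from a lattice square by $\ell$ successive subdivisions into four congruent squares. A *partition* $P$ of $\Omega$ is a finite set of pairwise disjoint cells (of possibly different levels) whose closures cover $\overline\Omega$ exactly. Put $h_\omega=\operatorname{diam}(\omega)$. The *edges* of a cell are its four open sides; an edge is *interior* if it is contained in $\Omega$. Let $r\ge 2$, let $\mathcal{P}^r_P(\Omega)$ be the functions that on each cell of $P$ are polynomials of degree at most $r$ in each variable, and let $\mathbb{X}_P\subseteq\mathcal{P}^r_P(\Omega)\cap C^1(\Omega)$ be a spline space spanned by a finite set $\mathcal{B}_P$ (for instance a hierarchical B-spline basis). For $\tau\in P$ let $\omega_\tau$ be the set of all $\tau'\in P$ for which some $\beta\in\mathcal{B}_P$ has a support that meets both $\tau$ and $\tau'$. For a constant $c_{\rm shape}>0$ the partition (with its basis) is called *shape regular* if for every $\tau\in P$ $$\#\,\omega_\tau\le c_{\rm shape},\qquad h_\tau\le c_{\rm shape}\,h_\sigma\ \text{ for every edge }\sigma\text{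 of a cell of }P\text{ with }\sigma\subset\partial\tau,\qquad \operatorname{diam}\Big(\bigcup_{\tau'\in\omega_\tau}\tau'\Big)\le c_{\rm shape}\,h_\tau .$$ Given $f\in L^2(\Omega)$, set $$\eta_P^2(V,\tau)=h_\tau^4\|f-\Delta^2V\|_{L^2(\tau)}^2+\sum_{\sigma}\Big(h_\sigma^3\Big\|\Big[\!\Big[\tfrac{\partial\Delta V}{\partial n_\sigma}\Big]\!\Big]_\sigma\Big\|_{L^2(\sigma)}^2+h_\sigma\big\|[\![\Delta V]\!]_\sigma\big\|_{L^2(\sigma)}^2\Big),$$ where the sum is over the interior edges $\sigma$ of $\tau$ and $[\![\cdot]\!]_\sigma$ is the jump across $\sigma$. For $S\subseteq P$ put $\eta_P^2(V,S)=\sum_{\tau\in S}\eta_P^2(V,\tau)$ and $\eta_P^2(V,\Omega)=\eta_P^2(V,P)$. Finally let $|\!|\!|w|\!|\!|=\|\Delta w\|_{L^2(\Omega)}$. **Lemma (Estimator error reduction).** For every $r\ge2$ and $c_{\rm shape}>0$ there is a constant $C>0$, depending only on $r$ and $c_{\rm shape}$, such that the following holds. Let $P$ be a partition of $\Omega$ that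 is shape regular with constant $c_{\rm shape}$, let $\mathcal{M}\subseteq P$, and let $P_*$ be a partition of $\Omega$, also shape regular with constant $c_{\rm shape}$, that is obtained from $P$ by subdividing cells, where every cell of $\mathcal{M}$ is subdivided at least once. Then for every $f\in L^2(\Omega)$, every $\delta>0$ and all splines $V\in\mathbb{X}_P$ and $V_*\in\mathbb{X}_{P_*}$, $$\eta_{P_*}^2(V_*,\Omega)\le(1+\delta)\Big\{\eta_P^2(V,\Omega)-\tfrac12\,\eta_P^2(V,\mathcal{M})\Big\}+C\Big(1+\frac1\delta\Big)|\!|\!|V-V_*|\!|\!|^2 .$$ -/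

import Mathlib

open MeasureTheory Set Filter Topology

noncomputable section

namespace SplineAFEM

/-- The Euclidean plane. -/
abbrev Plane := EuclideanSpace ℝ (Fin 2)

/-- The uniform initial grid of squares: a lattice point and the side length of its cells. Cells of
level `ℓ` are obtained by `ℓ` successive subdivisions of a square into four congruent squares. -/
structure Grid where
  origin : Plane
  size : ℝ
  size_pos : 0 < size

/-- A square cell is named by its level and its two integer lattice indices at that level. -/
abbrev Cell := ℕ × (Fin 2 → ℤ)

/-- An edge (side) of a square: the coordinate direction normal to it, and whether it is the upper
(`true`) or the lower (`false`) one of the two sides normal to that direction. -/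
abbrev Side := Fin 2 × Bool

namespace Grid

variable (G : Grid)

/-- Side length of the cell `τ`. -/
def len (τ : Cell) : ℝ := G.size / 2 ^ τ.1

/-- Coordinates of the lower left corner of the cell `τ`. -/
def corner (τ : Cell) (i : Fin 2) : ℝ := G.origin i + G.len τ * (τ.2 i : ℝ)

/-- The open square `τ`. -/
def cell (τ : Cell) : Set Plane :=
  {x | ∀ i, G.corner τ i < x i ∧ x i < G.corner τ i + G.len τ}

/-- The closed square. -/
def closedCell (τ : Cell) : Set Plane :=
  {x | ∀ i, G.corner τ i ≤ x i ∧ x i ≤ G.corner τ i + G.len τ}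

/-- The polygonal domain `Ω` made of finitely many cells of the initial grid. -/
def domain (Q : Finset (Fin 2 → ℤ)) : Set Plane :=
  interior (⋃ k ∈ Q, G.closedCell (0, k))

/-- `P` is a hierarchical partition of `Ω` into disjoint open squares. -/
def IsPartition (Q : Finset (Fin 2 → ℤ)) (P : Finset Cell) : Prop :=
  (P : Set Cell).PairwiseDisjoint G.cell ∧
    ⋃ τ ∈ P, G.closedCell τ = closure (G.domain Q)

/-- `Ps` is a refinement of the partition `P` in which every cell of the marked set `M` has been
subdivided (further cells may have been subdivided as well, and cells may have been subdivided
repeatedly). -/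
def IsRefinement (P M Ps : Finset Cell) : Prop :=
  (∀ τs ∈ Ps, ∃ τ ∈ P, G.cell τs ⊆ G.cell τ) ∧ ∀ τ ∈ M, τ ∉ Ps

/-- The point of the line carrying the side `e` of `τ` whose tangential coordinate is `t`. -/
def sidePoint (τ : Cell) (e : Side) (t : ℝ) : Plane :=
  WithLp.toLp 2 (Function.update (fun _ => t) e.1
    (G.corner τ e.1 + if e.2 then G.len τ else 0))

/-- The side `e` of `τ`, without its endpoints. -/
def side (τ : Cell) (e : Side) : Set Plane :=
  G.sidePoint τ e '' Ioo (G.corner τ (1 - e.1)) (G.corner τ (1 - e.1) + G.len τ)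

/-- The square of the `L²` norm of `g` on the side `e` of `τ`, in arc length. -/
def sideL2Sq (τ : Cell) (e : Side) (g : Plane → ℝ) : ℝ :=
  ∫ t in (G.corner τ (1 - e.1))..(G.corner τ (1 - e.1) + G.len τ), g (G.sidePoint τ e t) ^ 2

end Grid

/-- The outward unit normal on the side `e` of a square. -/
def normal (e : Side) : Plane := EuclideanSpace.single e.1 (if e.2 then 1 else -1)

/-- The jump of `g` at `x` in the direction `n`: the difference of the one-sided limits along the
normal line. -/
def jump (n : Plane) (g : Plane → ℝ) (x : Plane) : ℝ :=
  limUnder (𝓝[>] (0 : ℝ)) (fun t => g (x + t • n)) -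
    limUnder (𝓝[>] (0 : ℝ)) (fun t => g (x - t • n))

/-- The classical Laplacian. For a `C¹` piecewise polynomial function it is defined off the edges
of the cells, that is almost everywhere, and agrees there with the weak Laplacian. -/
def lap (V : Plane → ℝ) : Plane → ℝ := Laplacian.laplacian V

namespace Grid

variable (G : Grid)

/-- `V` lies in `𝒫ʳ_P(Ω) ∩ C¹(Ω)`: it is continuously differentiable on `Ω` and on every cell a
polynomial of degree at most `r` in each variable. -/
def IsSpline (Q : Finset (Fin 2 → ℤ)) (r : ℕ) (P : Finset Cell) (V : Plane → ℝ) : Prop :=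
  ContDiffOn ℝ 1 V (G.domain Q) ∧
    ∀ τ ∈ P, ∃ p : MvPolynomial (Fin 2) ℝ, (∀ i, p.degreeOf i ≤ r) ∧
      ∀ x ∈ G.cell τ, V x = MvPolynomial.eval (fun i => x i) p

/-- The support extension `ω_τ` of `τ` relative to the basis functions `B`: all cells that meet the
support of a basis function whose support meets `τ`. (Cells are open, so it makes no difference
whether the supports are closed up.) -/
def supportExtension (P : Finset Cell) (B : Finset (Plane → ℝ)) (τ : Cell) : Set Cell :=
  {τ' | τ' ∈ P ∧ ∃ β ∈ B, (Function.support β ∩ G.cell τ).Nonempty ∧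
    (Function.support β ∩ G.cell τ').Nonempty}

/-- The shape regularity conditions with constant `c`: finite intersection, mesh grading and
quasi-uniformity. In the mesh grading condition `σ` runs through the sides of all cells of `P`
that are contained in the boundary of `τ`, so sides of smaller neighbours are included. -/
def ShapeRegular (P : Finset Cell) (B : Finset (Plane → ℝ)) (c : ℝ) : Prop :=
  (∀ τ ∈ P, ((G.supportExtension P B τ).ncard : ℝ) ≤ c) ∧
  (∀ τ ∈ P, ∀ τ' ∈ P, ∀ e : Side, G.side τ' e ⊆ frontier (G.cell τ) →
    Metric.diam (G.cell τ) ≤ c * Metric.diam (G.side τ' e)) ∧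
  (∀ τ ∈ P, Metric.diam (⋃ τ' ∈ G.supportExtension P B τ, G.cell τ') ≤
    c * Metric.diam (G.cell τ))

open Classical in
/-- The error indicator `η²(V, τ)`: the element residual of `Δ²V = f` on `τ`, and the jumps of
`∂ΔV/∂n` and `ΔV` across those sides of `τ` that are interior to `Ω`. -/
def indicatorSq (Q : Finset (Fin 2 → ℤ)) (f V : Plane → ℝ) (τ : Cell) : ℝ :=
  Metric.diam (G.cell τ) ^ 4 * (∫ x in G.cell τ, (f x - lap (lap V) x) ^ 2) +
    ∑ e : Side, if G.side τ e ⊆ G.domain Q then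
      Metric.diam (G.side τ e) ^ 3 *
          G.sideL2Sq τ e (jump (normal e) fun y => fderiv ℝ (lap V) y (normal e)) +
        Metric.diam (G.side τ e) * G.sideL2Sq τ e (jump (normal e) (lap V))
    else 0

/-- The error estimator `η²(V, S)` over a set `S` of cells. -/
def estimatorSq (Q : Finset (Fin 2 → ℤ)) (f V : Plane → ℝ) (S : Finset Cell) : ℝ :=
  ∑ τ ∈ S, G.indicatorSq Q f V τ

/-- The square `‖Δw‖²` in `L²(Ω)` of the energy norm. -/
def energySq (Q : Finset (Fin 2 → ℤ)) (w : Plane → ℝ) : ℝ :=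
  ∫ x in G.domain Q, lap w x ^ 2

end Grid

end SplineAFEM

end

/-!
For a fixed spline `V`, refinement alone does not increase the estimator: the cells of `Ps` inside
a cell `τ` of `P` have disjoint residuals and smaller weights, and the jumps of `V` vanish on every
side that runs through the interior of `τ`. On a subdivided cell the mesh size at least halves, so
the weights, which contain at least one power of it, gain the factor `1/2`. Young's inequality then
passes from `V` to `Vs` at the price of the estimator of `V - Vs` with `f = 0`. That estimator is
controlled by the energy: on a square of side length `h`, inverse and trace inequalities bound
polynomials of bounded degree by their `L²` norms with the right powers of `h`, by
finite-dimensionality on the unit interval and scaling, and the mesh grading makes the weights on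
both sides of an edge comparable.
-/

noncomputable section

namespace SplineAFEM

section PolynomialFunctions

variable {ι : Type*}

/-- The function on `ℝ^ι` defined by a polynomial. -/
def polyFun : MvPolynomial ι ℝ →ₐ[ℝ] (EuclideanSpace ℝ ι → ℝ) :=
  AlgHom.pi fun x => MvPolynomial.aeval fun i => x i

theorem polyFun_apply (p : MvPolynomial ι ℝ) (x : EuclideanSpace ℝ ι) :
    polyFun p x = MvPolynomial.eval (fun i => x i) p := by
  simp [polyFun]

theorem continuous_polyFun (p : MvPolynomial ι ℝ) : Continuous (polyFun p) :=
  p.continuous_eval.comp (PiLp.continuous_ofLp 2 fun _ : ι => ℝ)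

theorem hasFDerivAt_polyFun [Fintype ι] (p : MvPolynomial ι ℝ) (x : EuclideanSpace ℝ ι) :
    HasFDerivAt (polyFun p)
      (∑ i, polyFun (MvPolynomial.pderiv i p) x •
        (EuclideanSpace.proj i : EuclideanSpace ℝ ι →L[ℝ] ℝ)) x := by
  classical
  induction p using MvPolynomial.induction_on with
  | C a =>
    have hC : polyFun (MvPolynomial.C a) = fun _ : EuclideanSpace ℝ ι => a := by
      ext; simp [polyFun_apply]
    rw [hC]
    simpa using hasFDerivAt_const a x
  | add p q hp hq =>
    rw [map_add]
    refine (hp.add hq).congr_fderiv ?_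
    simp only [map_add, Pi.add_apply, add_smul, Finset.sum_add_distrib]
  | mul_X p j hp =>
    have hX : polyFun (p * MvPolynomial.X j) =
        polyFun p * fun y => EuclideanSpace.proj (𝕜 := ℝ) j y := by
      ext; simp [polyFun_apply]
    rw [hX]
    refine (hp.mul (EuclideanSpace.proj (𝕜 := ℝ) j).hasFDerivAt).congr_fderiv ?_
    ext v
    simp [polyFun_apply, MvPolynomial.pderiv_X, Pi.single_apply, add_mul, Finset.sum_add_distrib,
      Finset.mul_sum, apply_ite, mul_assoc]

theorem fderiv_polyFun_single [Finite ι] [DecidableEq ι] (p : MvPolynomial ι ℝ)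
    (x : EuclideanSpace ℝ ι) (i : ι) (a : ℝ) :
    fderiv ℝ (polyFun p) x (EuclideanSpace.single i a) =
      a * polyFun (MvPolynomial.pderiv i p) x := by
  cases nonempty_fintype ι
  simp [(hasFDerivAt_polyFun p x).fderiv, mul_comm]

theorem differentiableAt_fderiv_polyFun [Finite ι] (p : MvPolynomial ι ℝ)
    (x : EuclideanSpace ℝ ι) :
    DifferentiableAt ℝ (fderiv ℝ (polyFun p)) x := by
  cases nonempty_fintype ι
  rw [funext fun y => (hasFDerivAt_polyFun p y).fderiv]
  exact DifferentiableAt.fun_sum fun i _ =>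
    (hasFDerivAt_polyFun _ x).differentiableAt.smul_const _

theorem fderiv_single_eqOn_polyFun [Finite ι] [DecidableEq ι] {U : Set (EuclideanSpace ℝ ι)}
    (hU : IsOpen U) {g : EuclideanSpace ℝ ι → ℝ} {p : MvPolynomial ι ℝ} (h : EqOn g (polyFun p) U)
    (i : ι) (a : ℝ) :
    EqOn (fun y => fderiv ℝ g y (EuclideanSpace.single i a))
      (polyFun (a • MvPolynomial.pderiv i p)) U := fun x hx => by
  simp only [(h.eventuallyEq_of_mem (hU.mem_nhds hx)).fderiv_eq, fderiv_polyFun_single, map_smul,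
    Pi.smul_apply, smul_eq_mul]

variable [Fintype ι]

/-- The Laplacian of a polynomial, as a polynomial. -/
def lapPoly : MvPolynomial ι ℝ →ₗ[ℝ] MvPolynomial ι ℝ :=
  ∑ i, (MvPolynomial.pderiv i).toLinearMap ∘ₗ (MvPolynomial.pderiv i).toLinearMap

theorem lapPoly_apply (p : MvPolynomial ι ℝ) :
    lapPoly p = ∑ i, MvPolynomial.pderiv i (MvPolynomial.pderiv i p) := by
  simp [lapPoly]

theorem laplacian_polyFun (p : MvPolynomial ι ℝ) :
    Laplacian.laplacian (polyFun p) = polyFun (lapPoly p) := by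
  classical
  have second_pderiv (x : EuclideanSpace ℝ ι) (i : ι) :
      fderiv ℝ (fderiv ℝ (polyFun p)) x (EuclideanSpace.single i 1) (EuclideanSpace.single i 1) =
        polyFun (MvPolynomial.pderiv i (MvPolynomial.pderiv i p)) x := by
    have h := fderiv_polyFun_single (MvPolynomial.pderiv i p) x i 1
    rw [show polyFun (MvPolynomial.pderiv i p) =
        fun y => fderiv ℝ (polyFun p) y (EuclideanSpace.single i 1) from
        funext fun y => by rw [fderiv_polyFun_single, one_mul],
      fderiv_clm_apply (differentiableAt_fderiv_polyFun p x) (differentiableAt_const _)] at h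
    simpa using h
  rw [InnerProductSpace.laplacian_eq_iteratedFDeriv_orthonormalBasis _
    (EuclideanSpace.basisFun ι ℝ)]
  ext x
  simp [iteratedFDeriv_two_apply, second_pderiv, lapPoly_apply]

theorem laplacian_eqOn_polyFun {U : Set (EuclideanSpace ℝ ι)} (hU : IsOpen U)
    {g : EuclideanSpace ℝ ι → ℝ} {p : MvPolynomial ι ℝ} (h : EqOn g (polyFun p) U) :
    EqOn (Laplacian.laplacian g) (polyFun (lapPoly p)) U := fun x hx => by
  rw [← laplacian_polyFun]
  exact (InnerProductSpace.laplacian_congr_nhds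
    (h.eventuallyEq_of_mem (hU.mem_nhds hx))).eq_of_nhds

end PolynomialFunctions

section PolynomialDegree

variable {σ R : Type*} [CommSemiring R] {r : ℕ} {p : MvPolynomial σ R}

theorem mem_restrictDegree_iff_degreeOf_le :
    p ∈ MvPolynomial.restrictDegree σ R r ↔ ∀ i, p.degreeOf i ≤ r := by
  simp only [MvPolynomial.mem_restrictDegree, MvPolynomial.degreeOf_le_iff]
  exact ⟨fun h i s hs => h s hs i, fun h s hs i => h i s hs⟩

theorem pderiv_mem_restrictDegree (hp : p ∈ MvPolynomial.restrictDegree σ R r) (i : σ) :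
    MvPolynomial.pderiv i p ∈ MvPolynomial.restrictDegree σ R r := by
  classical
  rw [MvPolynomial.mem_restrictDegree] at *
  intro s hs j
  rw [MvPolynomial.mem_support_iff, MvPolynomial.coeff_pderiv] at hs
  have h := hp (s + Finsupp.single i 1) (MvPolynomial.mem_support_iff.2 (left_ne_zero_of_mul hs)) j
  rw [Finsupp.add_apply] at h
  lia

theorem lapPoly_mem_restrictDegree {ι : Type*} [Fintype ι] {p : MvPolynomial ι ℝ}
    (hp : p ∈ MvPolynomial.restrictDegree ι ℝ r) :
    lapPoly p ∈ MvPolynomial.restrictDegree ι ℝ r := by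
  rw [lapPoly_apply]
  exact Submodule.sum_mem _ fun i _ => pderiv_mem_restrictDegree (pderiv_mem_restrictDegree hp i) i

variable [DecidableEq σ]

/-- The restriction of a polynomial to the line through `x` in the `i`-th coordinate direction,
as a polynomial in the `i`-th coordinate. -/
def coordLine (i : σ) (x : σ → R) : MvPolynomial σ R →ₐ[R] Polynomial R :=
  MvPolynomial.aeval (Function.update (fun j => Polynomial.C (x j)) i Polynomial.X)

theorem eval_coordLine (i : σ) (x : σ → R) (p : MvPolynomial σ R) (s : R) :
    (coordLine i x p).eval s = MvPolynomial.eval (Function.update x i s) p := by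
  have h : (Polynomial.aeval s).comp (coordLine i x) =
      MvPolynomial.aeval (Function.update x i s) := by
    refine MvPolynomial.algHom_ext fun j => ?_
    rcases eq_or_ne j i with rfl | hj <;> simp [coordLine, *]
  simpa [MvPolynomial.coe_aeval_eq_eval] using DFunLike.congr_fun h p

theorem derivative_coordLine (i : σ) (x : σ → R) (p : MvPolynomial σ R) :
    (coordLine i x p).derivative = coordLine i x (MvPolynomial.pderiv i p) := by
  induction p using MvPolynomial.induction_on with
  | C a => simp [coordLine]
  | add p q hp hq => simp only [map_add, hp, hq]
  | mul_X p j hp =>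
    have hX : (coordLine i x (MvPolynomial.X j)).derivative =
        coordLine i x (MvPolynomial.pderiv i (MvPolynomial.X j)) := by
      rcases eq_or_ne j i with rfl | hj <;> simp [coordLine, MvPolynomial.pderiv_X, *]
    simp only [MvPolynomial.pderiv_mul, map_add, map_mul, Polynomial.derivative_mul, hp, hX]

theorem natDegree_coordLine_le (i : σ) (x : σ → R) (p : MvPolynomial σ R) :
    (coordLine i x p).natDegree ≤ p.degreeOf i := by
  rw [coordLine, MvPolynomial.aeval_def, MvPolynomial.eval₂_eq]
  refine Polynomial.natDegree_sum_le_of_forall_le _ _ fun d hd => ?_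
  refine (Polynomial.natDegree_C_mul_le _ _).trans ((Polynomial.natDegree_prod_le _ _).trans ?_)
  calc ∑ j ∈ d.support,
        (Function.update (fun j => Polynomial.C (x j)) i Polynomial.X j ^ d j).natDegree
      ≤ ∑ j ∈ d.support, if j = i then d i else 0 := by
        gcongr with j
        rcases eq_or_ne j i with rfl | hj
        · simpa using Polynomial.natDegree_X_pow_le (R := R) (d j)
        · rw [Function.update_of_ne hj, if_neg hj, ← Polynomial.C_pow, Polynomial.natDegree_C]
    _ ≤ d i := by
        rw [Finset.sum_ite_eq']
        split_ifs <;> simp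
    _ ≤ p.degreeOf i := MvPolynomial.monomial_le_degreeOf i hd

theorem natDegree_coordLine_le_of_mem_restrictDegree
    (hp : p ∈ MvPolynomial.restrictDegree σ R r) (i : σ) (x : σ → R) :
    (coordLine i x p).natDegree ≤ r :=
  (natDegree_coordLine_le i x p).trans (mem_restrictDegree_iff_degreeOf_le.1 hp i)

end PolynomialDegree

section InverseEstimates

theorem exists_norm_le_mul_norm_of_injective {E F F' : Type*} [AddCommGroup E] [Module ℝ E]
    [FiniteDimensional ℝ E] [NormedAddCommGroup F] [NormedSpace ℝ F] [NormedAddCommGroup F']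
    [NormedSpace ℝ F'] (T : E →ₗ[ℝ] F) (J : E →ₗ[ℝ] F') (hJ : Function.Injective J) :
    ∃ K, 0 < K ∧ ∀ x, ‖T x‖ ≤ K * ‖J x‖ := by
  obtain ⟨K, hK, hb⟩ :=
    (T ∘ₗ (LinearEquiv.ofInjective J hJ).symm.toLinearMap).toContinuousLinearMap.bound
  refine ⟨K, hK, fun x => ?_⟩
  simpa using hb (LinearEquiv.ofInjective J hJ x)

open Polynomial

theorem norm_toLp_toContinuousMapOn_sq (p : ℝ[X]) :
    ‖ContinuousMap.toLp 2 volume ℝ (p.toContinuousMapOn unitInterval)‖ ^ 2 =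
      ∫ x in (0 : ℝ)..1, p.eval x ^ 2 := by
  rw [← real_inner_self_eq_norm_sq, ContinuousMap.inner_toLp,
    intervalIntegral.integral_of_le zero_le_one, ← integral_Icc_eq_integral_Ioc,
    ← unitInterval.measurePreserving_coe.integral_comp unitInterval.measurableEmbedding_coe]
  simp [sq]

theorem eq_zero_of_integral_eval_sq_eq_zero {p : ℝ[X]}
    (h : ∫ x in (0 : ℝ)..1, p.eval x ^ 2 = 0) : p = 0 := by
  by_contra hp
  obtain ⟨x, hx, hpx⟩ : ∃ x ∈ Icc (0 : ℝ) 1, ¬ p.IsRoot x := by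
    by_contra! hroot
    exact hp (p.eq_zero_of_infinite_isRoot ((Icc_infinite zero_lt_one).mono hroot))
  exact (intervalIntegral.integral_pos zero_lt_one (by fun_prop) (fun x _ => sq_nonneg (p.eval x))
    ⟨x, hx, by rw [IsRoot.def] at hpx; positivity⟩).ne' h

theorem exists_eval_sq_le_integral (r : ℕ) (T : ℝ[X] →ₗ[ℝ] ℝ[X]) :
    ∃ K, 0 < K ∧ ∀ p : ℝ[X], p.natDegree ≤ r → ∀ x ∈ Icc (0 : ℝ) 1,
      (T p).eval x ^ 2 ≤ K * ∫ y in (0 : ℝ)..1, p.eval y ^ 2 := by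
  let S : ℝ[X] →ₗ[ℝ] C(unitInterval, ℝ) := (toContinuousMapOnAlgHom unitInterval).toLinearMap
  let J : degreeLT ℝ (r + 1) →ₗ[ℝ] Lp ℝ 2 (volume : Measure unitInterval) :=
    (ContinuousMap.toLp 2 volume ℝ).toLinearMap ∘ₗ S ∘ₗ (degreeLT ℝ (r + 1)).subtype
  have hJ : Function.Injective J := by
    refine (injective_iff_map_eq_zero J).2 fun p hp => Subtype.ext ?_
    refine eq_zero_of_integral_eval_sq_eq_zero ?_
    rw [← norm_toLp_toContinuousMapOn_sq, sq_eq_zero_iff, norm_eq_zero]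
    exact hp
  have : FiniteDimensional ℝ (degreeLT ℝ (r + 1)) :=
    Module.Finite.equiv (degreeLTEquiv ℝ (r + 1)).symm
  obtain ⟨K, hK, hb⟩ :=
    exists_norm_le_mul_norm_of_injective (S ∘ₗ T ∘ₗ (degreeLT ℝ (r + 1)).subtype) J hJ
  refine ⟨K ^ 2, by positivity, fun p hp x hx => ?_⟩
  have hpmem : p ∈ degreeLT ℝ (r + 1) :=
    mem_degreeLT.2 ((degree_le_of_natDegree_le hp).trans_lt (by exact_mod_cast r.lt_succ_self))
  rw [← norm_toLp_toContinuousMapOn_sq, ← mul_pow, ← sq_abs]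
  refine pow_le_pow_left₀ (abs_nonneg _) ?_ 2
  exact ((S (T p)).norm_coe_le_norm ⟨x, hx⟩).trans (hb ⟨p, hpmem⟩)

/-- The pullback of a polynomial under the affine map `x ↦ h x + a`. -/
def affinePullback (a h : ℝ) (p : ℝ[X]) : ℝ[X] := p.comp (C h * X + C a)

theorem natDegree_affinePullback_le (a h : ℝ) (p : ℝ[X]) :
    (affinePullback a h p).natDegree ≤ p.natDegree :=
  natDegree_comp_le.trans
    ((Nat.mul_le_mul_left _ (natDegree_linear_le (a := h) (b := a))).trans_eq (mul_one _))

theorem eval_affinePullback (a h x : ℝ) (p : ℝ[X]) :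
    (affinePullback a h p).eval x = p.eval (h * x + a) := by simp [affinePullback]

theorem derivative_affinePullback (a h : ℝ) (p : ℝ[X]) :
    (affinePullback a h p).derivative = C h * affinePullback a h p.derivative := by
  simp [affinePullback, derivative_comp]

theorem integral_affinePullback_sq (a h : ℝ) (p : ℝ[X]) :
    h * ∫ y in (0 : ℝ)..1, (affinePullback a h p).eval y ^ 2 =
      ∫ s in a..(a + h), p.eval s ^ 2 := by
  simpa [eval_affinePullback, add_comm] using
    intervalIntegral.mul_integral_comp_mul_add (a := 0) (b := 1) (f := fun s => p.eval s ^ 2) h a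

theorem exists_mul_eval_sq_le_integral (r : ℕ) : ∃ K, 0 < K ∧ ∀ p : ℝ[X], p.natDegree ≤ r →
    ∀ a h : ℝ, 0 < h → ∀ y ∈ Icc a (a + h),
      h * p.eval y ^ 2 ≤ K * ∫ s in a..(a + h), p.eval s ^ 2 := by
  obtain ⟨K, hK, H⟩ := exists_eval_sq_le_integral r LinearMap.id
  refine ⟨K, hK, fun p hp a h hh y hy => ?_⟩
  have hy' : (y - a) / h ∈ Icc (0 : ℝ) 1 :=
    ⟨div_nonneg (by linarith [hy.1]) hh.le, by rw [div_le_one hh]; linarith [hy.2]⟩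
  have hbound := H _ ((natDegree_affinePullback_le a h p).trans hp) _ hy'
  rw [LinearMap.id_apply, eval_affinePullback, mul_div_cancel₀ _ hh.ne', sub_add_cancel] at hbound
  rw [← integral_affinePullback_sq, mul_left_comm]
  gcongr

theorem exists_integral_derivative_sq_le (r : ℕ) : ∃ K, 0 < K ∧ ∀ p : ℝ[X], p.natDegree ≤ r →
    ∀ a h : ℝ, 0 < h →
      h ^ 2 * (∫ s in a..(a + h), p.derivative.eval s ^ 2) ≤
        K * ∫ s in a..(a + h), p.eval s ^ 2 := by
  obtain ⟨K, hK, H⟩ := exists_eval_sq_le_integral r derivative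
  refine ⟨K, hK, fun p hp a h hh => ?_⟩
  have hbound : h ^ 2 * (∫ y in (0 : ℝ)..1, (affinePullback a h p.derivative).eval y ^ 2) ≤
      ∫ _ in (0 : ℝ)..1, K * ∫ y in (0 : ℝ)..1, (affinePullback a h p).eval y ^ 2 := by
    rw [← intervalIntegral.integral_const_mul]
    refine intervalIntegral.integral_mono_on zero_le_one
      (Continuous.intervalIntegrable (by fun_prop) _ _) (by simp) fun y hy => ?_
    simpa [derivative_affinePullback, mul_pow] using
      H _ ((natDegree_affinePullback_le a h p).trans hp) y hy
  rw [intervalIntegral.integral_const, sub_zero, one_smul] at hbound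
  rw [← integral_affinePullback_sq, ← integral_affinePullback_sq, mul_left_comm, mul_left_comm K]
  gcongr

end InverseEstimates

section Coordinates

/-- The point of the plane whose `i`-th coordinate is `s` and whose other coordinate is `t`. -/
def pt (i : Fin 2) (s t : ℝ) : Plane := WithLp.toLp 2 (Function.update (fun _ => t) i s)

theorem one_sub_ne (i : Fin 2) : 1 - i ≠ i := by fin_cases i <;> simp

theorem forall_fin_two_iff {q : Fin 2 → Prop} (i : Fin 2) : (∀ j, q j) ↔ q i ∧ q (1 - i) := by
  fin_cases i <;> simp [Fin.forall_fin_two, and_comm]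

@[simp] theorem pt_apply_self (i : Fin 2) (s t : ℝ) : pt i s t i = s := by simp [pt]

@[simp] theorem pt_apply_other (i : Fin 2) (s t : ℝ) : pt i s t (1 - i) = t := by
  simp [pt, one_sub_ne]

theorem pt_coordinates (i : Fin 2) (x : Plane) : pt i (x i) (x (1 - i)) = x :=
  PiLp.ext ((forall_fin_two_iff i).2 (by simp))

theorem continuous_pt (i : Fin 2) : Continuous fun z : ℝ × ℝ => pt i z.1 z.2 := by
  unfold pt
  fun_prop

theorem dist_pt_pt (i : Fin 2) (z t z' t' : ℝ) :
    dist (pt i z t) (pt i z' t') = √((z - z') ^ 2 + (t - t') ^ 2) := by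
  rw [EuclideanSpace.dist_eq, Fin.sum_univ_two]
  fin_cases i <;> simp [pt, Real.dist_eq, sq_abs, add_comm]

theorem pt_add_smul_normal (e : Side) (z t s : ℝ) :
    pt e.1 z t + s • normal e = pt e.1 (z + if e.2 then s else -s) t :=
  PiLp.ext ((forall_fin_two_iff e.1).2 (by simp [normal, one_sub_ne]))

theorem measurePreserving_pt_zero :
    MeasurePreserving (fun z : ℝ × ℝ => pt 0 z.1 z.2) volume volume := by
  have hpt : (fun z : ℝ × ℝ => pt 0 z.1 z.2) =
      WithLp.toLp 2 ∘ (MeasurableEquiv.finTwoArrow (α := ℝ)).symm := by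
    funext z
    refine PiLp.ext fun j => ?_
    fin_cases j <;> simp [pt, MeasurableEquiv.finTwoArrow]
  rw [hpt]
  exact (PiLp.volume_preserving_toLp (Fin 2)).comp (volume_preserving_finTwoArrow ℝ).symm

theorem measurePreserving_pt (i : Fin 2) :
    MeasurePreserving (fun z : ℝ × ℝ => pt i z.1 z.2) volume volume := by
  fin_cases i
  · exact measurePreserving_pt_zero
  · have hpt : (fun z : ℝ × ℝ => pt 1 z.1 z.2) = (fun z => pt 0 z.1 z.2) ∘ Prod.swap := by
      funext z
      refine PiLp.ext fun j => ?_
      fin_cases j <;> simp [pt]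
    exact hpt ▸ measurePreserving_pt_zero.comp Measure.measurePreserving_swap

theorem measurableEmbedding_pt (i : Fin 2) :
    MeasurableEmbedding (fun z : ℝ × ℝ => pt i z.1 z.2) :=
  (continuous_pt i).measurableEmbedding fun z w h => Prod.ext
    (by simpa using congrArg (fun x : Plane => x i) h)
    (by simpa using congrArg (fun x : Plane => x (1 - i)) h)

theorem polyFun_pt (p : MvPolynomial (Fin 2) ℝ) (i : Fin 2) (s t : ℝ) :
    polyFun p (pt i s t) = (coordLine i (fun _ => t) p).eval s := by
  rw [eval_coordLine, polyFun_apply]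
  rfl

theorem continuous_lineIntegral {F : Plane → ℝ} (hF : Continuous F) (i : Fin 2) (a b : ℝ) :
    Continuous fun t => ∫ s in a..b, F (pt i s t) := by
  refine intervalIntegral.continuous_parametric_intervalIntegral_of_continuous' ?_ a b
  exact hF.comp ((continuous_pt i).comp continuous_swap)

end Coordinates

namespace Grid

variable (G : Grid)

section Cells

theorem len_pos (τ : Cell) : 0 < G.len τ := div_pos G.size_pos (by positivity)

theorem pt_mem_cell {τ : Cell} {i : Fin 2} {s t : ℝ} :
    pt i s t ∈ G.cell τ ↔ s ∈ Ioo (G.corner τ i) (G.corner τ i + G.len τ) ∧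
      t ∈ Ioo (G.corner τ (1 - i)) (G.corner τ (1 - i) + G.len τ) := by
  rw [cell, mem_ofPred_eq, forall_fin_two_iff i]
  simp

theorem pt_mem_closedCell {τ : Cell} {i : Fin 2} {s t : ℝ} :
    pt i s t ∈ G.closedCell τ ↔ s ∈ Icc (G.corner τ i) (G.corner τ i + G.len τ) ∧
      t ∈ Icc (G.corner τ (1 - i)) (G.corner τ (1 - i) + G.len τ) := by
  rw [closedCell, mem_ofPred_eq, forall_fin_two_iff i]
  simp

theorem isOpen_cell (τ : Cell) : IsOpen (G.cell τ) := by
  simp only [cell, ofPred_forall, ofPred_and]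
  exact isOpen_iInter_of_finite fun i =>
    (isOpen_lt (by fun_prop) (by fun_prop)).inter (isOpen_lt (by fun_prop) (by fun_prop))

theorem isClosed_closedCell (τ : Cell) : IsClosed (G.closedCell τ) := by
  simp only [closedCell, ofPred_forall, ofPred_and]
  exact isClosed_iInter fun i =>
    (isClosed_le (by fun_prop) (by fun_prop)).inter (isClosed_le (by fun_prop) (by fun_prop))

theorem measurableSet_cell (τ : Cell) : MeasurableSet (G.cell τ) := (G.isOpen_cell τ).measurableSet

theorem cell_subset_closedCell (τ : Cell) : G.cell τ ⊆ G.closedCell τ :=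
  fun _ hx i => ⟨(hx i).1.le, (hx i).2.le⟩

theorem nonempty_cell (τ : Cell) : (G.cell τ).Nonempty := by
  have hl := G.len_pos τ
  exact ⟨pt 0 (G.corner τ 0 + G.len τ / 2) (G.corner τ (1 - 0) + G.len τ / 2),
    G.pt_mem_cell.2 ⟨⟨by linarith, by linarith⟩, ⟨by linarith, by linarith⟩⟩⟩

theorem dist_le_of_mem_closedCell {τ : Cell} {x y : Plane} (hx : x ∈ G.closedCell τ)
    (hy : y ∈ G.closedCell τ) : dist x y ≤ √2 * G.len τ := by
  have hl := G.len_pos τ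
  have hcoord (i : Fin 2) : dist (x i) (y i) ^ 2 ≤ G.len τ ^ 2 := by
    rw [Real.dist_eq, sq_abs]
    exact sq_le_sq' (by linarith [hx i, hy i]) (by linarith [hx i, hy i])
  rw [EuclideanSpace.dist_eq]
  refine Real.sqrt_le_iff.2 ⟨by positivity, ?_⟩
  rw [mul_pow, Real.sq_sqrt zero_le_two, Fin.sum_univ_two]
  linarith [hcoord 0, hcoord 1]

theorem isCompact_closedCell (τ : Cell) : IsCompact (G.closedCell τ) :=
  Metric.isCompact_of_isClosed_isBounded (G.isClosed_closedCell τ)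
    (Metric.isBounded_iff.2 ⟨_, fun _ hx _ hy => G.dist_le_of_mem_closedCell hx hy⟩)

theorem isBounded_cell (τ : Cell) : Bornology.IsBounded (G.cell τ) :=
  (G.isCompact_closedCell τ).isBounded.subset (G.cell_subset_closedCell τ)

theorem diam_cell (τ : Cell) : Metric.diam (G.cell τ) = √2 * G.len τ := by
  have hl := G.len_pos τ
  refine le_antisymm (Metric.diam_le_of_forall_dist_le (by positivity) fun x hx y hy =>
    G.dist_le_of_mem_closedCell (G.cell_subset_closedCell τ hx) (G.cell_subset_closedCell τ hy)) ?_
  have mem_cell {d : ℝ} (hd : d ∈ Ioo 0 (G.len τ)) :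
      pt 0 (G.corner τ 0 + d) (G.corner τ (1 - 0) + d) ∈ G.cell τ :=
    G.pt_mem_cell.2 ⟨by simpa using hd, by simpa using hd⟩
  have diagonal_le {d : ℝ} (hd : d ∈ Ioo 0 (G.len τ / 2)) :
      √2 * (G.len τ - 2 * d) ≤ Metric.diam (G.cell τ) := by
    have hdist := Metric.dist_le_diam_of_mem (G.isBounded_cell τ)
      (mem_cell (d := G.len τ - d) ⟨by linarith [hd.2], by linarith [hd.1]⟩)
      (mem_cell (d := d) ⟨hd.1, by linarith [hd.2]⟩)
    refine le_of_eq_of_le ?_ hdist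
    rw [dist_pt_pt, ← Real.sqrt_sq (show 0 ≤ G.len τ - 2 * d by linarith [hd.2]),
      ← Real.sqrt_mul zero_le_two]
    congr 1
    ring
  have hlim : Tendsto (fun d => √2 * (G.len τ - 2 * d)) (𝓝[>] 0) (𝓝 (√2 * (G.len τ - 2 * 0))) :=
    (Continuous.tendsto (by fun_prop) 0).mono_left nhdsWithin_le_nhds
  rw [mul_zero, sub_zero] at hlim
  exact le_of_tendsto hlim (eventually_of_mem (Ioo_mem_nhdsGT (half_pos hl)) fun d => diagonal_le)

theorem integrableOn_cell_of_continuous {F : Plane → ℝ} (hF : Continuous F) (τ : Cell) :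
    IntegrableOn F (G.cell τ) :=
  (hF.continuousOn.integrableOn_compact (G.isCompact_closedCell τ)).mono_set
    (G.cell_subset_closedCell τ)

theorem setIntegral_cell {F : Plane → ℝ} (hF : Continuous F) (τ : Cell) (i : Fin 2) :
    ∫ x in G.cell τ, F x =
      ∫ t in (G.corner τ (1 - i))..(G.corner τ (1 - i) + G.len τ),
        ∫ s in (G.corner τ i)..(G.corner τ i + G.len τ), F (pt i s t) := by
  have hl := G.len_pos τ
  have hpre : (fun z : ℝ × ℝ => pt i z.1 z.2) ⁻¹' G.cell τ =
      Ioo (G.corner τ i) (G.corner τ i + G.len τ) ×ˢ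
        Ioo (G.corner τ (1 - i)) (G.corner τ (1 - i) + G.len τ) := by
    ext z
    simp only [mem_preimage, pt_mem_cell, mem_prod]
  have hinteg := ((measurePreserving_pt i).integrableOn_comp_preimage (measurableEmbedding_pt i)).2
    (G.integrableOn_cell_of_continuous hF τ)
  rw [hpre, Measure.volume_eq_prod, IntegrableOn, ← Measure.prod_restrict] at hinteg
  rw [← (measurePreserving_pt i).setIntegral_preimage_emb (measurableEmbedding_pt i), hpre,
    Measure.volume_eq_prod, ← Measure.prod_restrict,
    integral_prod_symm (fun z : ℝ × ℝ => F (pt i z.1 z.2)) hinteg]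
  simp only [intervalIntegral.integral_of_le (le_add_of_nonneg_right hl.le),
    integral_Ioc_eq_integral_Ioo]

end Cells

section Sides

/-- The normal coordinate of the line carrying the side `e` of `τ`. -/
def sideCoord (τ : Cell) (e : Side) : ℝ := G.corner τ e.1 + if e.2 then G.len τ else 0

/-- The range of the tangential coordinate on the side `e` of `τ`. -/
def sideIoo (τ : Cell) (e : Side) : Set ℝ :=
  Ioo (G.corner τ (1 - e.1)) (G.corner τ (1 - e.1) + G.len τ)

theorem measurableSet_sideIoo (τ : Cell) (e : Side) : MeasurableSet (G.sideIoo τ e) :=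
  measurableSet_Ioo

theorem sidePoint_eq_pt (τ : Cell) (e : Side) (t : ℝ) :
    G.sidePoint τ e t = pt e.1 (G.sideCoord τ e) t := rfl

theorem sideCoord_mem_Icc (τ : Cell) (e : Side) :
    G.sideCoord τ e ∈ Icc (G.corner τ e.1) (G.corner τ e.1 + G.len τ) := by
  have := G.len_pos τ
  unfold sideCoord
  split_ifs <;> constructor <;> linarith

theorem continuous_sidePoint (τ : Cell) (e : Side) : Continuous (G.sidePoint τ e) :=
  (continuous_pt e.1).comp (continuous_const.prodMk continuous_id)

theorem diam_side (τ : Cell) (e : Side) : Metric.diam (G.side τ e) = G.len τ := by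
  have hiso : Isometry (G.sidePoint τ e) := Isometry.of_dist_eq fun t t' => by
    simp [sidePoint_eq_pt, dist_pt_pt, Real.sqrt_sq_eq_abs, Real.dist_eq]
  rw [side, hiso.diam_image, Real.diam_Ioo (le_add_of_nonneg_right (G.len_pos τ).le),
    add_sub_cancel_left]

theorem sideL2Sq_eq_setIntegral (τ : Cell) (e : Side) (g : Plane → ℝ) :
    G.sideL2Sq τ e g = ∫ t in G.sideIoo τ e, g (G.sidePoint τ e t) ^ 2 := by
  rw [sideL2Sq, intervalIntegral.integral_of_le (le_add_of_nonneg_right (G.len_pos τ).le),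
    integral_Ioc_eq_integral_Ioo]
  rfl

theorem sideL2Sq_nonneg (τ : Cell) (e : Side) (g : Plane → ℝ) : 0 ≤ G.sideL2Sq τ e g := by
  rw [sideL2Sq_eq_setIntegral]
  exact integral_nonneg fun t => sq_nonneg _

theorem sideL2Sq_smul (τ : Cell) (e : Side) (a : ℝ) (g : Plane → ℝ) :
    G.sideL2Sq τ e (a • g) = a ^ 2 * G.sideL2Sq τ e g := by
  simp only [sideL2Sq, Pi.smul_apply, smul_eq_mul, mul_pow, intervalIntegral.integral_const_mul]

end Sides

end Grid

section CellInverseEstimates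

variable (r : ℕ)

theorem exists_integral_pderiv_sq_le : ∃ K, 0 < K ∧
    ∀ p ∈ MvPolynomial.restrictDegree (Fin 2) ℝ r, ∀ (G : Grid) (τ : Cell) (i : Fin 2),
      G.len τ ^ 2 * (∫ x in G.cell τ, polyFun (MvPolynomial.pderiv i p) x ^ 2) ≤
        K * ∫ x in G.cell τ, polyFun p x ^ 2 := by
  obtain ⟨K, hK, H⟩ := exists_integral_derivative_sq_le r
  refine ⟨K, hK, fun p hp G τ i => ?_⟩
  have hl := G.len_pos τ
  have hcont (q : MvPolynomial (Fin 2) ℝ) : Continuous fun x => polyFun q x ^ 2 :=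
    (continuous_polyFun q).pow 2
  rw [G.setIntegral_cell (hcont _) τ i, G.setIntegral_cell (hcont _) τ i,
    ← intervalIntegral.integral_const_mul, ← intervalIntegral.integral_const_mul]
  refine intervalIntegral.integral_mono_on (by linarith)
    ((continuous_const.mul (continuous_lineIntegral (hcont _) i _ _)).intervalIntegrable _ _)
    ((continuous_const.mul (continuous_lineIntegral (hcont _) i _ _)).intervalIntegrable _ _)
    fun t _ => ?_
  simp only [polyFun_pt, ← derivative_coordLine]
  exact H _ (natDegree_coordLine_le_of_mem_restrictDegree hp i _) _ _ hl

theorem exists_sideL2Sq_le : ∃ K, 0 < K ∧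
    ∀ p ∈ MvPolynomial.restrictDegree (Fin 2) ℝ r, ∀ (G : Grid) (τ : Cell) (e : Side),
      G.len τ * G.sideL2Sq τ e (polyFun p) ≤ K * ∫ x in G.cell τ, polyFun p x ^ 2 := by
  obtain ⟨K, hK, H⟩ := exists_mul_eval_sq_le_integral r
  refine ⟨K, hK, fun p hp G τ e => ?_⟩
  have hl := G.len_pos τ
  have hcont : Continuous fun x => polyFun p x ^ 2 := (continuous_polyFun p).pow 2
  rw [G.setIntegral_cell hcont τ e.1, Grid.sideL2Sq,
    ← intervalIntegral.integral_const_mul, ← intervalIntegral.integral_const_mul]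
  refine intervalIntegral.integral_mono_on (by linarith)
    ((continuous_const.mul (hcont.comp (G.continuous_sidePoint τ e))).intervalIntegrable _ _)
    ((continuous_const.mul (continuous_lineIntegral hcont e.1 _ _)).intervalIntegrable _ _)
    fun t _ => ?_
  simp only [polyFun_pt, G.sidePoint_eq_pt]
  exact H _ (natDegree_coordLine_le_of_mem_restrictDegree hp e.1 _) _ _ hl _
    (G.sideCoord_mem_Icc τ e)

theorem exists_sideL2Sq_pderiv_le : ∃ K, 0 < K ∧
    ∀ p ∈ MvPolynomial.restrictDegree (Fin 2) ℝ r, ∀ (G : Grid) (τ : Cell) (e : Side) (i : Fin 2),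
      G.len τ ^ 3 * G.sideL2Sq τ e (polyFun (MvPolynomial.pderiv i p)) ≤
        K * ∫ x in G.cell τ, polyFun p x ^ 2 := by
  obtain ⟨K₁, hK₁, trace⟩ := exists_sideL2Sq_le r
  obtain ⟨K₂, hK₂, inverse⟩ := exists_integral_pderiv_sq_le r
  refine ⟨K₁ * K₂, by positivity, fun p hp G τ e i => ?_⟩
  have hl := G.len_pos τ
  calc G.len τ ^ 3 * G.sideL2Sq τ e (polyFun (MvPolynomial.pderiv i p))
      = G.len τ ^ 2 * (G.len τ * G.sideL2Sq τ e (polyFun (MvPolynomial.pderiv i p))) := by ring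
    _ ≤ G.len τ ^ 2 * (K₁ * ∫ x in G.cell τ, polyFun (MvPolynomial.pderiv i p) x ^ 2) := by
        gcongr G.len τ ^ 2 * ?_
        exact trace _ (pderiv_mem_restrictDegree hp i) G τ e
    _ = K₁ * (G.len τ ^ 2 * ∫ x in G.cell τ, polyFun (MvPolynomial.pderiv i p) x ^ 2) := by ring
    _ ≤ K₁ * (K₂ * ∫ x in G.cell τ, polyFun p x ^ 2) := by
        gcongr K₁ * ?_
        exact inverse p hp G τ i
    _ = K₁ * K₂ * ∫ x in G.cell τ, polyFun p x ^ 2 := by ring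

theorem exists_integral_pderiv_pderiv_sq_le : ∃ K, 0 < K ∧
    ∀ p ∈ MvPolynomial.restrictDegree (Fin 2) ℝ r, ∀ (G : Grid) (τ : Cell) (i j : Fin 2),
      G.len τ ^ 4 *
          (∫ x in G.cell τ, polyFun (MvPolynomial.pderiv i (MvPolynomial.pderiv j p)) x ^ 2) ≤
        K * ∫ x in G.cell τ, polyFun p x ^ 2 := by
  obtain ⟨K, hK, inverse⟩ := exists_integral_pderiv_sq_le r
  refine ⟨K * K, by positivity, fun p hp G τ i j => ?_⟩
  have hl := G.len_pos τ
  calc _ = G.len τ ^ 2 * (G.len τ ^ 2 *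
        ∫ x in G.cell τ, polyFun (MvPolynomial.pderiv i (MvPolynomial.pderiv j p)) x ^ 2) := by ring
    _ ≤ G.len τ ^ 2 * (K * ∫ x in G.cell τ, polyFun (MvPolynomial.pderiv j p) x ^ 2) := by
        gcongr G.len τ ^ 2 * ?_
        exact inverse _ (pderiv_mem_restrictDegree hp j) G τ i
    _ = K * (G.len τ ^ 2 * ∫ x in G.cell τ, polyFun (MvPolynomial.pderiv j p) x ^ 2) := by ring
    _ ≤ K * (K * ∫ x in G.cell τ, polyFun p x ^ 2) := by
        gcongr K * ?_
        exact inverse p hp G τ j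
    _ = K * K * ∫ x in G.cell τ, polyFun p x ^ 2 := by ring

theorem exists_integral_lapPoly_sq_le : ∃ K, 0 < K ∧
    ∀ p ∈ MvPolynomial.restrictDegree (Fin 2) ℝ r, ∀ (G : Grid) (τ : Cell),
      G.len τ ^ 4 * (∫ x in G.cell τ, polyFun (lapPoly p) x ^ 2) ≤
        K * ∫ x in G.cell τ, polyFun p x ^ 2 := by
  obtain ⟨K, hK, inverse⟩ := exists_integral_pderiv_pderiv_sq_le r
  refine ⟨4 * K, by positivity, fun p hp G τ => ?_⟩
  have hl := G.len_pos τ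
  let D (i : Fin 2) : MvPolynomial (Fin 2) ℝ := MvPolynomial.pderiv i (MvPolynomial.pderiv i p)
  have hinteg (i : Fin 2) : IntegrableOn (fun x => 2 * polyFun (D i) x ^ 2) (G.cell τ) :=
    G.integrableOn_cell_of_continuous (continuous_const.mul ((continuous_polyFun _).pow 2)) τ
  have hle : ∫ x in G.cell τ, polyFun (lapPoly p) x ^ 2 ≤
      2 * (∫ x in G.cell τ, polyFun (D 0) x ^ 2) + 2 * ∫ x in G.cell τ, polyFun (D 1) x ^ 2 := by
    rw [← integral_const_mul, ← integral_const_mul, ← integral_add (hinteg 0) (hinteg 1)]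
    refine integral_mono
      (G.integrableOn_cell_of_continuous ((continuous_polyFun _).pow 2) τ)
      ((hinteg 0).add (hinteg 1)) fun x => ?_
    simp only [lapPoly_apply, Fin.sum_univ_two, map_add, Pi.add_apply]
    exact add_sq_le.trans_eq (mul_add _ _ _)
  calc _ ≤ G.len τ ^ 4 * (2 * (∫ x in G.cell τ, polyFun (D 0) x ^ 2) +
        2 * ∫ x in G.cell τ, polyFun (D 1) x ^ 2) := by gcongr
    _ ≤ 4 * K * ∫ x in G.cell τ, polyFun p x ^ 2 := by
        linarith [inverse p hp G τ 0 0, inverse p hp G τ 1 1]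

end CellInverseEstimates

theorem tendsto_add_smul_nhdsGT_zero {E : Type*} [NormedAddCommGroup E] [NormedSpace ℝ E]
    (x n : E) : Tendsto (fun s : ℝ => x + s • n) (𝓝[>] 0) (𝓝 x) := by
  have h : Tendsto (fun s : ℝ => x + s • n) (𝓝 0) (𝓝 (x + (0 : ℝ) • n)) :=
    Continuous.tendsto (by fun_prop) 0
  rw [zero_smul, add_zero] at h
  exact h.mono_left nhdsWithin_le_nhds

theorem tendsto_sub_smul_nhdsGT_zero {E : Type*} [NormedAddCommGroup E] [NormedSpace ℝ E]
    (x n : E) : Tendsto (fun s : ℝ => x - s • n) (𝓝[>] 0) (𝓝 x) := by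
  simpa [sub_eq_add_neg] using tendsto_add_smul_nhdsGT_zero x (-n)

/-- The side of a square opposite to `e`. -/
def Side.opp (e : Side) : Side := (e.1, !e.2)

theorem normal_opp (e : Side) : normal e.opp = -normal e := by
  rcases e with ⟨i, b⟩
  refine PiLp.ext fun j => ?_
  cases b <;> by_cases h : j = i <;> simp [normal, Side.opp, h]

namespace Grid

variable (G : Grid)

section SidesAndCells

theorem sideCoord_opp (τ : Cell) (e : Side) :
    G.sideCoord τ e.opp = G.corner τ e.1 + if e.2 then 0 else G.len τ := by
  rcases e with ⟨i, b⟩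
  cases b <;> simp [sideCoord, Side.opp]

theorem sideCoord_notMem_Ioo (τ : Cell) (e : Side) :
    G.sideCoord τ e ∉ Ioo (G.corner τ e.1) (G.corner τ e.1 + G.len τ) := by
  unfold sideCoord
  split_ifs <;> simp

theorem eq_sideCoord_or_eq_sideCoord_opp {τ : Cell} {e : Side} {z : ℝ}
    (hIcc : z ∈ Icc (G.corner τ e.1) (G.corner τ e.1 + G.len τ))
    (hIoo : z ∉ Ioo (G.corner τ e.1) (G.corner τ e.1 + G.len τ)) :
    z = G.sideCoord τ e ∨ z = G.sideCoord τ e.opp := by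
  have hz : z = G.corner τ e.1 ∨ z = G.corner τ e.1 + G.len τ := by
    by_contra! h
    exact hIoo ⟨lt_of_le_of_ne hIcc.1 h.1.symm, lt_of_le_of_ne hIcc.2 h.2⟩
  rw [sideCoord_opp, sideCoord]
  cases e.2 <;> simpa [or_comm] using hz

theorem eventually_sub_normal_mem_cell {τ : Cell} {e : Side} {t : ℝ} (ht : t ∈ G.sideIoo τ e) :
    ∀ᶠ s in 𝓝[>] (0 : ℝ), G.sidePoint τ e t - s • normal e ∈ G.cell τ := by
  filter_upwards [Ioo_mem_nhdsGT (G.len_pos τ)] with s hs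
  rw [sub_eq_add_neg, ← neg_smul, sidePoint_eq_pt, pt_add_smul_normal, pt_mem_cell]
  refine ⟨?_, ht⟩
  unfold sideCoord
  cases e.2
  · simpa using hs
  · simpa using hs.symm

theorem eventually_add_normal_mem_cell {τ τ' : Cell} {e : Side} {t : ℝ}
    (ht : t ∈ G.sideIoo τ' e) (hz : G.sideCoord τ' e.opp = G.sideCoord τ e) :
    ∀ᶠ s in 𝓝[>] (0 : ℝ), G.sidePoint τ e t + s • normal e ∈ G.cell τ' := by
  have h := G.eventually_sub_normal_mem_cell (τ := τ') (e := e.opp) ht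
  simp only [normal_opp, sidePoint_eq_pt, hz, smul_neg, sub_neg_eq_add] at h
  exact h

theorem add_normal_notMem_closedCell (τ : Cell) (e : Side) (t : ℝ) {s : ℝ} (hs : 0 < s) :
    G.sidePoint τ e t + s • normal e ∉ G.closedCell τ := by
  rw [sidePoint_eq_pt, pt_add_smul_normal, pt_mem_closedCell]
  unfold sideCoord
  cases e.2 <;> simp [hs]

theorem side_subset_frontier {τ τ' : Cell} {e e' : Side} (he : e'.1 = e.1)
    (hz : G.sideCoord τ' e' = G.sideCoord τ e)
    (hI : G.sideIoo τ' e' ⊆ G.sideIoo τ e) : G.side τ' e' ⊆ frontier (G.cell τ) := by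
  rintro _ ⟨t, ht, rfl⟩
  rw [(G.isOpen_cell τ).frontier_eq, sidePoint_eq_pt, hz, he, ← sidePoint_eq_pt]
  refine ⟨mem_closure_of_tendsto (tendsto_sub_smul_nhdsGT_zero _ (normal e))
    (G.eventually_sub_normal_mem_cell (hI ht)), fun h => ?_⟩
  rw [sidePoint_eq_pt, pt_mem_cell] at h
  exact G.sideCoord_notMem_Ioo τ e h.1

end SidesAndCells

section DyadicNesting

theorem corner_bounds_of_level_le {τ τ' : Cell} {i : Fin 2} {t : ℝ} (hlev : τ.1 ≤ τ'.1)
    (ht : t ∈ Icc (G.corner τ i) (G.corner τ i + G.len τ))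
    (ht' : t ∈ Ioo (G.corner τ' i) (G.corner τ' i + G.len τ')) :
    G.corner τ i ≤ G.corner τ' i ∧ G.corner τ' i + G.len τ' ≤ G.corner τ i + G.len τ := by
  obtain ⟨d, hd⟩ := Nat.exists_eq_add_of_le hlev
  have hL := G.len_pos τ'
  have hlen : G.len τ = 2 ^ d * G.len τ' := by
    simp only [len, hd, pow_add]
    field_simp
  simp only [corner, hlen, mem_Icc, mem_Ioo] at *
  have hlower : (2 : ℝ) ^ d * τ.2 i < τ'.2 i + 1 := lt_of_mul_lt_mul_left (by linarith) hL.le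
  have hupper : (τ'.2 i : ℝ) < 2 ^ d * τ.2 i + 2 ^ d := lt_of_mul_lt_mul_left (by linarith) hL.le
  have hlower' : (2 : ℝ) ^ d * τ.2 i ≤ τ'.2 i := by
    exact_mod_cast
      Int.lt_add_one_iff.1 (by exact_mod_cast hlower : (2 : ℤ) ^ d * τ.2 i < τ'.2 i + 1)
  have hupper' : (τ'.2 i : ℝ) + 1 ≤ 2 ^ d * τ.2 i + 2 ^ d := by
    exact_mod_cast Int.add_one_le_iff.2
      (by exact_mod_cast hupper : τ'.2 i < (2 : ℤ) ^ d * τ.2 i + 2 ^ d)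
  constructor <;> nlinarith

theorem len_le_of_level_le {τ τ' : Cell} (h : τ.1 ≤ τ'.1) : G.len τ' ≤ G.len τ :=
  div_le_div_of_nonneg_left G.size_pos.le (by positivity) (pow_le_pow_right₀ one_le_two h)

theorem corner_bounds_of_cell_subset {τ τ' : Cell} (h : G.cell τ' ⊆ G.cell τ) (i : Fin 2) :
    G.corner τ i ≤ G.corner τ' i ∧ G.corner τ' i + G.len τ' ≤ G.corner τ i + G.len τ := by
  have hl := G.len_pos τ'
  refine (Ioo_subset_Ioo_iff (by linarith)).1 fun s hs => ?_
  have hmem : pt i s (G.corner τ' (1 - i) + G.len τ' / 2) ∈ G.cell τ' :=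
    G.pt_mem_cell.2 ⟨hs, ⟨by linarith, by linarith⟩⟩
  exact (G.pt_mem_cell.1 (h hmem)).1

theorem sideIoo_subset_of_cell_subset {τ τ' : Cell} (h : G.cell τ' ⊆ G.cell τ) (e : Side) :
    G.sideIoo τ' e ⊆ G.sideIoo τ e :=
  have hc := G.corner_bounds_of_cell_subset h (1 - e.1)
  Ioo_subset_Ioo hc.1 hc.2

theorem len_le_of_cell_subset {τ τ' : Cell} (h : G.cell τ' ⊆ G.cell τ) : G.len τ' ≤ G.len τ := by
  linarith [G.corner_bounds_of_cell_subset h 0]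

theorem level_lt_of_cell_subset {τ τ' : Cell} (h : G.cell τ' ⊆ G.cell τ) (hne : τ' ≠ τ) :
    τ.1 < τ'.1 := by
  by_contra! hle
  have hlen : G.len τ' = G.len τ :=
    le_antisymm (G.len_le_of_cell_subset h) (G.len_le_of_level_le hle)
  have hlevel : τ'.1 = τ.1 := by
    simp only [len, div_eq_mul_inv] at hlen
    have hpow := inv_injective (mul_left_cancel₀ G.size_pos.ne' hlen)
    exact Nat.pow_right_injective le_rfl (by exact_mod_cast hpow)
  refine hne (Prod.ext hlevel (funext fun i => ?_))
  have hcorner : G.corner τ' i = G.corner τ i := by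
    linarith [G.corner_bounds_of_cell_subset h i]
  simp only [corner, hlen, add_right_inj] at hcorner
  exact_mod_cast mul_left_cancel₀ (G.len_pos τ).ne' hcorner

theorem len_le_half_of_cell_subset {τ τ' : Cell} (h : G.cell τ' ⊆ G.cell τ) (hne : τ' ≠ τ) :
    G.len τ' ≤ 1 / 2 * G.len τ := by
  refine (G.len_le_of_level_le (τ := (τ.1 + 1, τ.2)) (G.level_lt_of_cell_subset h hne)).trans_eq ?_
  simp only [len, pow_succ]
  field_simp

theorem pt_mem_domain {Q : Finset (Fin 2 → ℤ)} {τ : Cell} {i : Fin 2} {z t t' : ℝ}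
    (ht : t ∈ Ioo (G.corner τ (1 - i)) (G.corner τ (1 - i) + G.len τ))
    (ht' : t' ∈ Ioo (G.corner τ (1 - i)) (G.corner τ (1 - i) + G.len τ))
    (h : pt i z t' ∈ G.domain Q) : pt i z t ∈ G.domain Q := by
  rw [domain, mem_interior_iff_mem_nhds] at h ⊢
  have hproj : Continuous fun y : Plane => pt i (y i) t' :=
    (continuous_pt i).comp (by fun_prop : Continuous fun y : Plane => (y i, t'))
  have hcoord : Continuous fun y : Plane => y (1 - i) := by fun_prop
  filter_upwards [hproj.continuousAt.preimage_mem_nhds (x := pt i z t) (by simpa using h),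
    hcoord.continuousAt.preimage_mem_nhds (x := pt i z t)
      (Ioo_mem_nhds (by simpa using ht.1) (by simpa using ht.2))] with y hy hy'
  simp only [mem_preimage, mem_iUnion₂, pt_mem_closedCell] at hy ⊢
  obtain ⟨k, hk, hyi, hk'⟩ := hy
  have hc := G.corner_bounds_of_level_le (τ := (0, k)) τ.1.zero_le hk' ht'
  refine ⟨k, hk, ?_⟩
  rw [← pt_coordinates i y, pt_mem_closedCell]
  exact ⟨hyi, hc.1.trans hy'.1.le, hy'.2.le.trans hc.2⟩

theorem side_subset_domain {Q : Finset (Fin 2 → ℤ)} {τ τ' : Cell} (h : G.cell τ' ⊆ G.cell τ)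
    {e : Side} (hz : G.sideCoord τ' e = G.sideCoord τ e) (he : G.side τ' e ⊆ G.domain Q) :
    G.side τ e ⊆ G.domain Q := by
  rintro _ ⟨t, ht, rfl⟩
  obtain ⟨t', ht'⟩ : (G.sideIoo τ' e).Nonempty := nonempty_Ioo.2 (by linarith [G.len_pos τ'])
  have hmem : G.sidePoint τ' e t' ∈ G.domain Q := he ⟨t', ht', rfl⟩
  rw [sidePoint_eq_pt, hz] at hmem
  exact G.pt_mem_domain ht (G.sideIoo_subset_of_cell_subset h e ht') hmem

end DyadicNesting

section Partitions

variable {G} {Q : Finset (Fin 2 → ℤ)} {P : Finset Cell} {τ τ' : Cell}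

theorem IsPartition.cell_subset_domain (hP : G.IsPartition Q P) (hτ : τ ∈ P) :
    G.cell τ ⊆ G.domain Q := by
  have hclosure : closure (G.domain Q) ⊆ ⋃ k ∈ Q, G.closedCell (0, k) :=
    closure_minimal interior_subset (isClosed_biUnion_finset fun k _ => G.isClosed_closedCell _)
  refine interior_maximal (((G.cell_subset_closedCell τ).trans ?_).trans hclosure) (G.isOpen_cell τ)
  rw [← hP.2]
  exact subset_biUnion_of_mem (u := fun τ => G.closedCell τ) hτ

theorem IsPartition.eq_of_mem_cell (hP : G.IsPartition Q P) (hτ : τ ∈ P) (hτ' : τ' ∈ P)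
    {x : Plane} (hx : x ∈ G.cell τ) (hx' : x ∈ G.cell τ') : τ = τ' :=
  hP.1.elim hτ hτ' (Set.not_disjoint_iff.2 ⟨x, hx, hx'⟩)

theorem IsPartition.eq_of_mem_sideIoo (hP : G.IsPartition Q P) (hτ : τ ∈ P) (hτ' : τ' ∈ P)
    {e : Side} (hz : G.sideCoord τ e = G.sideCoord τ' e) {t : ℝ}
    (ht : t ∈ G.sideIoo τ e) (ht' : t ∈ G.sideIoo τ' e) : τ = τ' := by
  have h := G.eventually_sub_normal_mem_cell ht
  rw [sidePoint_eq_pt, hz, ← sidePoint_eq_pt] at h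
  obtain ⟨s, hs, hs'⟩ := (h.and (G.eventually_sub_normal_mem_cell ht')).exists
  exact hP.eq_of_mem_cell hτ hτ' hs hs'

theorem IsPartition.exists_frequently_mem_closedCell (hP : G.IsPartition Q P) {x : Plane}
    (hx : x ∈ G.domain Q) (n : Plane) :
    ∃ τ' ∈ P, ∃ᶠ s in 𝓝[>] (0 : ℝ), x + s • n ∈ G.closedCell τ' := by
  by_contra! h
  obtain ⟨s, hs, hs'⟩ := (((eventually_all_finset P).2 h).and
    ((tendsto_add_smul_nhdsGT_zero x n).eventually (isOpen_interior.mem_nhds hx))).exists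
  have hcover : x + s • n ∈ ⋃ τ ∈ P, G.closedCell τ := hP.2.superset (subset_closure hs')
  obtain ⟨τ', hτ', hmem⟩ := mem_iUnion₂.1 hcover
  exact hs τ' hτ' hmem

theorem IsPartition.sideCoord_notMem_Ioo_of_mem (hP : G.IsPartition Q P) (hτ : τ ∈ P)
    (hτ' : τ' ∈ P) {e : Side} {t : ℝ} (ht : t ∈ G.sideIoo τ e) (ht' : t ∈ G.sideIoo τ' e) :
    G.sideCoord τ e ∉ Ioo (G.corner τ' e.1) (G.corner τ' e.1 + G.len τ') := fun hz => by
  have hmem : G.sidePoint τ e t ∈ G.cell τ' := G.pt_mem_cell.2 ⟨hz, ht'⟩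
  obtain ⟨s, hs, hs'⟩ := (((tendsto_sub_smul_nhdsGT_zero _ (normal e)).eventually
    ((G.isOpen_cell τ').mem_nhds hmem)).and (G.eventually_sub_normal_mem_cell ht)).exists
  obtain rfl := hP.eq_of_mem_cell hτ' hτ hs hs'
  exact G.sideCoord_notMem_Ioo τ' e hz

theorem IsPartition.sideCoord_opp_eq (hP : G.IsPartition Q P) (hτ : τ ∈ P) (hτ' : τ' ∈ P)
    {e : Side} {t : ℝ} (ht : t ∈ G.sideIoo τ e) (ht' : t ∈ G.sideIoo τ' e)
    (hfreq : ∃ᶠ s in 𝓝[>] (0 : ℝ), G.sidePoint τ e t + s • normal e ∈ G.closedCell τ') :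
    G.sideCoord τ' e.opp = G.sideCoord τ e := by
  have hmem : G.sidePoint τ e t ∈ G.closedCell τ' :=
    (G.isClosed_closedCell τ').mem_of_frequently_of_tendsto hfreq
      (tendsto_add_smul_nhdsGT_zero _ _)
  rcases G.eq_sideCoord_or_eq_sideCoord_opp (z := G.sideCoord τ e) (G.pt_mem_closedCell.1 hmem).1
    (hP.sideCoord_notMem_Ioo_of_mem hτ hτ' ht ht') with hz | hz
  · obtain ⟨s, hs, hs0⟩ := (hfreq.and_eventually self_mem_nhdsWithin).exists
    rw [sidePoint_eq_pt, hz, ← sidePoint_eq_pt] at hs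
    exact absurd hs (G.add_normal_notMem_closedCell τ' e t hs0)
  · exact hz.symm

theorem ae_forall_mem_sideIoo_of_mem_Icc (P : Finset Cell) (e : Side) :
    ∀ᵐ t : ℝ, ∀ τ ∈ P,
      t ∈ Icc (G.corner τ (1 - e.1)) (G.corner τ (1 - e.1) + G.len τ) → t ∈ G.sideIoo τ e := by
  refine (ae_ball_iff P.countable_toSet).2 fun τ _ => ?_
  filter_upwards [Measure.ae_ne volume (G.corner τ (1 - e.1)),
    Measure.ae_ne volume (G.corner τ (1 - e.1) + G.len τ)] with t h h' ht
  exact ⟨lt_of_le_of_ne ht.1 h.symm, lt_of_le_of_ne ht.2 h'⟩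

theorem IsPartition.ae_exists_neighbour (hP : G.IsPartition Q P) (hτ : τ ∈ P) {e : Side}
    (he : G.side τ e ⊆ G.domain Q) :
    ∀ᵐ t ∂(volume.restrict (G.sideIoo τ e)), ∃ τ' ∈ P, t ∈ G.sideIoo τ' e ∧
      G.sideCoord τ' e.opp = G.sideCoord τ e := by
  filter_upwards [ae_restrict_of_ae (ae_forall_mem_sideIoo_of_mem_Icc P e),
    ae_restrict_mem measurableSet_Ioo] with t hvertex ht
  obtain ⟨τ', hτ', hfreq⟩ := hP.exists_frequently_mem_closedCell (he ⟨t, ht, rfl⟩) (normal e)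
  obtain ⟨s, hs⟩ := hfreq.exists
  rw [sidePoint_eq_pt, pt_add_smul_normal, pt_mem_closedCell] at hs
  have ht' := hvertex τ' hτ' hs.2
  exact ⟨τ', hτ', ht', hP.sideCoord_opp_eq hτ hτ' ht ht' hfreq⟩

/-- The mesh grading condition of `ShapeRegular`: a cell is not much larger than any side of a cell
of `P` that lies in its boundary. -/
def IsGraded (G : Grid) (P : Finset Cell) (c : ℝ) : Prop :=
  ∀ τ ∈ P, ∀ τ' ∈ P, ∀ e : Side, G.side τ' e ⊆ frontier (G.cell τ) →
    Metric.diam (G.cell τ) ≤ c * Metric.diam (G.side τ' e)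

theorem IsGraded.len_le {c : ℝ} (hG : G.IsGraded P c) (hτ : τ ∈ P) (hτ' : τ' ∈ P) {e : Side}
    (hz : G.sideCoord τ' e.opp = G.sideCoord τ e) {t : ℝ} (ht : t ∈ G.sideIoo τ e)
    (ht' : t ∈ G.sideIoo τ' e) : G.len τ ≤ max 1 c * G.len τ' := by
  have hl := G.len_pos τ
  have hl' := G.len_pos τ'
  rcases le_total τ.1 τ'.1 with h | h
  · have hI := G.corner_bounds_of_level_le h (Ioo_subset_Icc_self ht) ht'
    have hdiam := hG τ hτ τ' hτ' e.opp
      (G.side_subset_frontier (e := e) rfl hz (Ioo_subset_Ioo hI.1 hI.2))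
    rw [diam_cell, diam_side] at hdiam
    calc G.len τ ≤ √2 * G.len τ := le_mul_of_one_le_left hl.le (by simp)
      _ ≤ c * G.len τ' := hdiam
      _ ≤ max 1 c * G.len τ' := by gcongr; exact le_max_right _ _
  · calc G.len τ ≤ 1 * G.len τ' := by rw [one_mul]; exact G.len_le_of_level_le h
      _ ≤ max 1 c * G.len τ' := by gcongr; exact le_max_left _ _

end Partitions

end Grid

section Integrals

theorem sum_indicator_sq {α ι : Type*} {S : Finset ι} {A : ι → Set α}
    (hd : (S : Set ι).PairwiseDisjoint A) (F : ι → α → ℝ) (x : α) :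
    (∑ i ∈ S, (A i).indicator (F i) x) ^ 2 =
      ∑ i ∈ S, (A i).indicator (fun x => F i x ^ 2) x := by
  by_cases hx : ∃ i ∈ S, x ∈ A i
  · obtain ⟨i, hi, hxi⟩ := hx
    have hother (j : ι) (hj : j ∈ S) (hne : j ≠ i) : x ∉ A j :=
      fun hxj => hne (hd.elim_set hj hi x hxj hxi)
    rw [Finset.sum_eq_single_of_mem i hi fun j hj hne => indicator_of_notMem (hother j hj hne) _,
      Finset.sum_eq_single_of_mem i hi fun j hj hne => indicator_of_notMem (hother j hj hne) _,
      indicator_of_mem hxi, indicator_of_mem hxi]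
  · push Not at hx
    rw [Finset.sum_eq_zero fun i hi => indicator_of_notMem (hx i hi) _,
      Finset.sum_eq_zero fun i hi => indicator_of_notMem (hx i hi) _, sq, mul_zero]

variable {α : Type*} [MeasurableSpace α] {μ : Measure α}

theorem sum_setIntegral_le {ι : Type*} (S : Finset ι) {A : ι → Set α} {T : Set α} {F : α → ℝ}
    (hA : ∀ i ∈ S, MeasurableSet (A i)) (hd : (S : Set ι).PairwiseDisjoint A)
    (hAT : ∀ i ∈ S, A i ⊆ T) (hF : ∀ x, 0 ≤ F x) (hinteg : IntegrableOn F T μ) :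
    ∑ i ∈ S, ∫ x in A i, F x ∂μ ≤ ∫ x in T, F x ∂μ := by
  rw [← integral_biUnion_finset S hA hd fun i hi => hinteg.mono_set (hAT i hi)]
  exact setIntegral_mono_set hinteg (Eventually.of_forall hF)
    (LE.le.eventuallyLE (iUnion₂_subset hAT))

theorem sub_sq_le_young {δ : ℝ} (hδ : 0 < δ) (a b : ℝ) :
    (a - b) ^ 2 ≤ (1 + δ) * a ^ 2 + (1 + 1 / δ) * b ^ 2 := by
  have h : (1 + δ) * a ^ 2 + (1 + 1 / δ) * b ^ 2 - (a - b) ^ 2 = (δ * a + b) ^ 2 / δ := by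
    field_simp
    ring
  exact sub_nonneg.1 (h ▸ by positivity)

theorem integral_sq_le_young {u v w : α → ℝ} (h : ∀ᵐ x ∂μ, u x = v x - w x) (hv : MemLp v 2 μ)
    (hw : MemLp w 2 μ) {δ : ℝ} (hδ : 0 < δ) :
    ∫ x, u x ^ 2 ∂μ ≤ (1 + δ) * (∫ x, v x ^ 2 ∂μ) + (1 + 1 / δ) * ∫ x, w x ^ 2 ∂μ := by
  have hv' := hv.integrable_sq.const_mul (1 + δ)
  have hw' := hw.integrable_sq.const_mul (1 + 1 / δ)
  rw [← integral_const_mul, ← integral_const_mul, ← integral_add hv' hw']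
  refine integral_mono_of_nonneg (Eventually.of_forall fun x => sq_nonneg _) (hv'.add hw') ?_
  filter_upwards [h] with x hx
  rw [hx]
  exact sub_sq_le_young hδ _ _

end Integrals

section Jumps

theorem limUnder_eq_of_eqOn {α X Y : Type*} [TopologicalSpace X] [TopologicalSpace Y] [T2Space Y]
    [Nonempty Y] {l : Filter α} [l.NeBot] {U : Set X} {g q : X → Y} (hg : EqOn g q U) {γ : α → X}
    {x : X} (hq : ContinuousAt q x) (hγ : Tendsto γ l (𝓝 x)) (hU : ∀ᶠ s in l, γ s ∈ U) :
    limUnder l (fun s => g (γ s)) = q x :=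
  ((hq.tendsto.comp hγ).congr' (hU.mono fun _ hs => (hg hs).symm)).limUnder_eq

theorem jump_eq_of_eventually_mem {U U' : Set Plane} {g q q' : Plane → ℝ} {x n : Plane}
    (hq : ContinuousAt q x) (hq' : ContinuousAt q' x) (hg : EqOn g q U) (hg' : EqOn g q' U')
    (hU : ∀ᶠ s in 𝓝[>] (0 : ℝ), x - s • n ∈ U) (hU' : ∀ᶠ s in 𝓝[>] (0 : ℝ), x + s • n ∈ U') :
    jump n g x = q' x - q x := by
  rw [jump, limUnder_eq_of_eqOn hg hq (tendsto_sub_smul_nhdsGT_zero x n) hU,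
    limUnder_eq_of_eqOn hg' hq' (tendsto_add_smul_nhdsGT_zero x n) hU']

theorem jump_eq_zero_of_continuousAt {g : Plane → ℝ} {x : Plane} (hg : ContinuousAt g x)
    (n : Plane) : jump n g x = 0 := by
  rw [jump_eq_of_eventually_mem hg hg (eqOn_refl g univ) (eqOn_refl g univ)
    (by simp) (by simp), sub_self]

end Jumps

namespace Grid

/-- On every cell `τ` of `P` the function `g` agrees with the polynomial `p τ`. -/
def HasPieces (G : Grid) (P : Finset Cell) (p : Cell → MvPolynomial (Fin 2) ℝ)
    (g : Plane → ℝ) : Prop := ∀ τ ∈ P, EqOn g (polyFun (p τ)) (G.cell τ)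

variable {G : Grid} {Q : Finset (Fin 2 → ℤ)} {P : Finset Cell} {τ τ' : Cell} {e : Side}
  {g : Plane → ℝ} {p : Cell → MvPolynomial (Fin 2) ℝ}

section Pieces

protected theorem HasPieces.lap (h : G.HasPieces P p g) :
    G.HasPieces P (lapPoly ∘ p) (lap g) :=
  fun τ hτ => laplacian_eqOn_polyFun (G.isOpen_cell τ) (h τ hτ)

theorem HasPieces.lap_sq_eqOn (h : G.HasPieces P p g) (hτ : τ ∈ P) :
    EqOn (fun x => lap g x ^ 2) (fun x => polyFun (lapPoly (p τ)) x ^ 2) (G.cell τ) :=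
  fun x hx => by simp only [h.lap τ hτ hx, Function.comp_apply]

theorem HasPieces.fderiv_normal (h : G.HasPieces P p g) (e : Side) :
    G.HasPieces P ((if e.2 then (1 : ℝ) else -1) • MvPolynomial.pderiv e.1 ∘ p)
      (fun y => fderiv ℝ g y (normal e)) :=
  fun τ hτ => fderiv_single_eqOn_polyFun (G.isOpen_cell τ) (h τ hτ) _ _

protected theorem HasPieces.sub {q : Cell → MvPolynomial (Fin 2) ℝ} {k : Plane → ℝ}
    (h : G.HasPieces P p g) (h' : G.HasPieces P q k) : G.HasPieces P (p - q) (g - k) :=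
  fun τ hτ x hx => by simp only [Pi.sub_apply, map_sub, h τ hτ hx, h' τ hτ hx]

theorem HasPieces.continuousAt (h : G.HasPieces P p g) (hτ : τ ∈ P) {x : Plane}
    (hx : x ∈ G.cell τ) : ContinuousAt g x :=
  (continuous_polyFun (p τ)).continuousAt.congr
    ((h τ hτ).symm.eventuallyEq_of_mem ((G.isOpen_cell τ).mem_nhds hx))

theorem HasPieces.jump_sidePoint (hg : G.HasPieces P p g) (hτ : τ ∈ P) (hτ' : τ' ∈ P)
    (hz : G.sideCoord τ' e.opp = G.sideCoord τ e) {t : ℝ} (ht : t ∈ G.sideIoo τ e)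
    (ht' : t ∈ G.sideIoo τ' e) :
    jump (normal e) g (G.sidePoint τ e t) =
      polyFun (p τ') (G.sidePoint τ e t) - polyFun (p τ) (G.sidePoint τ e t) :=
  jump_eq_of_eventually_mem (continuous_polyFun _).continuousAt (continuous_polyFun _).continuousAt
    (hg τ hτ) (hg τ' hτ') (G.eventually_sub_normal_mem_cell ht)
    (G.eventually_add_normal_mem_cell ht' hz)

theorem memLp_polyFun_sidePoint (q : MvPolynomial (Fin 2) ℝ) (τ : Cell) (e : Side) :
    MemLp (fun t => polyFun q (G.sidePoint τ e t)) 2 (volume.restrict (G.sideIoo τ e)) := by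
  have hcont := (continuous_polyFun q).comp (G.continuous_sidePoint τ e)
  exact (memLp_two_iff_integrable_sq hcont.aestronglyMeasurable).2
    (((hcont.pow 2).continuousOn.integrableOn_compact isCompact_Icc).mono_set Ioo_subset_Icc_self)

end Pieces

section OuterTraces

open Classical in
/-- The cells of `P` whose side opposite to `e` lies on the line carrying the side `e` of `τ`:
those among them that share a part of this side with `τ` are the neighbours of `τ` across it. -/
def facing (G : Grid) (P : Finset Cell) (τ : Cell) (e : Side) : Finset Cell :=
  P.filter fun τ' => G.sideCoord τ' e.opp = G.sideCoord τ e

theorem mem_facing : τ' ∈ G.facing P τ e ↔ τ' ∈ P ∧ G.sideCoord τ' e.opp = G.sideCoord τ e := by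
  simp [facing]

theorem mem_facing_opp_comm :
    τ ∈ P ∧ τ' ∈ G.facing P τ e ↔ τ ∈ G.facing P τ' e.opp ∧ τ' ∈ P := by
  have hopp : e.opp.opp = e := Prod.ext rfl (Bool.not_not e.2)
  rw [mem_facing, mem_facing, hopp, eq_comm (a := G.sideCoord τ e)]
  tauto

theorem sidePoint_of_mem_facing (h : τ' ∈ G.facing P τ e) (t : ℝ) :
    G.sidePoint τ' e.opp t = G.sidePoint τ e t := by
  rw [sidePoint_eq_pt, sidePoint_eq_pt, (mem_facing.1 h).2]
  rfl

theorem IsPartition.pairwiseDisjoint_sideIoo (hP : G.IsPartition Q P) {S : Finset Cell}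
    (hS : S ⊆ P) {e : Side} {z : ℝ} (hz : ∀ τ ∈ S, G.sideCoord τ e = z) :
    (S : Set Cell).PairwiseDisjoint fun τ => G.sideIoo τ e := fun τ hτ τ' hτ' hne =>
  Set.disjoint_left.2 fun _ ht ht' => hne <|
    hP.eq_of_mem_sideIoo (hS hτ) (hS hτ') ((hz τ hτ).trans (hz τ' hτ').symm) ht ht'

theorem IsPartition.pairwiseDisjoint_facing (hP : G.IsPartition Q P) (τ : Cell) (e : Side) :
    (G.facing P τ e : Set Cell).PairwiseDisjoint fun τ' => G.sideIoo τ' e :=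
  hP.pairwiseDisjoint_sideIoo (e := e.opp) (fun _ h => (mem_facing.1 h).1)
    fun _ h => (mem_facing.1 h).2

/-- The trace on the side `e` of `τ`, as a function of the tangential coordinate, of the pieces `p`
on the cells across this side. -/
def outerTrace (G : Grid) (P : Finset Cell) (p : Cell → MvPolynomial (Fin 2) ℝ) (τ : Cell)
    (e : Side) (t : ℝ) : ℝ :=
  ∑ τ' ∈ G.facing P τ e, (G.sideIoo τ' e).indicator (fun t => polyFun (p τ') (G.sidePoint τ e t)) t

theorem memLp_outerTrace :
    MemLp (G.outerTrace P p τ e) 2 (volume.restrict (G.sideIoo τ e)) :=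
  memLp_finsetSum _ fun _ _ => (memLp_polyFun_sidePoint _ τ e).indicator measurableSet_Ioo

theorem outerTrace_eq (hP : G.IsPartition Q P) (hτ' : τ' ∈ P)
    (hz : G.sideCoord τ' e.opp = G.sideCoord τ e) {t : ℝ} (ht' : t ∈ G.sideIoo τ' e) :
    G.outerTrace P p τ e t = polyFun (p τ') (G.sidePoint τ e t) := by
  have hmem : τ' ∈ G.facing P τ e := mem_facing.2 ⟨hτ', hz⟩
  rw [outerTrace, Finset.sum_eq_single_of_mem τ' hmem fun σ hσ hne => indicator_of_notMem
    (fun h => hne ((hP.pairwiseDisjoint_facing τ e).elim_set hσ hmem t h ht')) _,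
    indicator_of_mem ht']

theorem integral_outerTrace_sq (hP : G.IsPartition Q P) :
    ∫ t in G.sideIoo τ e, G.outerTrace P p τ e t ^ 2 =
      ∑ τ' ∈ G.facing P τ e, ∫ t in G.sideIoo τ e ∩ G.sideIoo τ' e,
        polyFun (p τ') (G.sidePoint τ' e.opp t) ^ 2 := by
  simp only [outerTrace, sum_indicator_sq (hP.pairwiseDisjoint_facing τ e)]
  rw [integral_finsetSum _ fun τ' _ =>
    (memLp_polyFun_sidePoint (p τ') τ e).integrable_sq.indicator (G.measurableSet_sideIoo τ' e)]
  refine Finset.sum_congr rfl fun τ' hτ' => ?_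
  rw [setIntegral_indicator (G.measurableSet_sideIoo τ' e)]
  simp only [sidePoint_of_mem_facing hτ']

theorem HasPieces.jump_ae_eq (hg : G.HasPieces P p g) (hP : G.IsPartition Q P) (hτ : τ ∈ P)
    (he : G.side τ e ⊆ G.domain Q) :
    ∀ᵐ t ∂(volume.restrict (G.sideIoo τ e)), jump (normal e) g (G.sidePoint τ e t) =
      G.outerTrace P p τ e t - polyFun (p τ) (G.sidePoint τ e t) := by
  filter_upwards [hP.ae_exists_neighbour hτ he, ae_restrict_mem measurableSet_Ioo]
    with t ⟨τ', hτ', ht', hz⟩ ht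
  rw [hg.jump_sidePoint hτ hτ' hz ht ht', outerTrace_eq hP hτ' hz ht']

theorem HasPieces.memLp_jump (hg : G.HasPieces P p g) (hP : G.IsPartition Q P) (hτ : τ ∈ P)
    (he : G.side τ e ⊆ G.domain Q) :
    MemLp (fun t => jump (normal e) g (G.sidePoint τ e t)) 2
      (volume.restrict (G.sideIoo τ e)) :=
  (memLp_congr_ae (hg.jump_ae_eq hP hτ he)).2
    (memLp_outerTrace.sub (memLp_polyFun_sidePoint (p τ) τ e))

theorem HasPieces.sideL2Sq_jump_le (hg : G.HasPieces P p g) (hP : G.IsPartition Q P) (hτ : τ ∈ P)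
    (he : G.side τ e ⊆ G.domain Q) :
    G.sideL2Sq τ e (jump (normal e) g) ≤
      2 * G.sideL2Sq τ e (polyFun (p τ)) +
        2 * ∑ τ' ∈ G.facing P τ e, ∫ t in G.sideIoo τ e ∩ G.sideIoo τ' e,
          polyFun (p τ') (G.sidePoint τ' e.opp t) ^ 2 := by
  have h := integral_sq_le_young (hg.jump_ae_eq hP hτ he) memLp_outerTrace
    (memLp_polyFun_sidePoint (p τ) τ e) one_pos
  rw [integral_outerTrace_sq hP, ← sideL2Sq_eq_setIntegral, ← sideL2Sq_eq_setIntegral] at h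
  linarith

end OuterTraces

section JumpTerms

open Classical in
/-- The contribution of the side `e` of `τ` to the error indicator, with the `k`-th power of the
length of the side as weight; it vanishes unless the side is interior. -/
def jumpTerm (G : Grid) (Q : Finset (Fin 2 → ℤ)) (g : Plane → ℝ) (k : ℕ) (τ : Cell)
    (e : Side) : ℝ :=
  if G.side τ e ⊆ G.domain Q then G.len τ ^ k * G.sideL2Sq τ e (jump (normal e) g) else 0

theorem jumpTerm_le_len_pow_mul_sideL2Sq (k : ℕ) (τ : Cell) (e : Side) :
    G.jumpTerm Q g k τ e ≤ G.len τ ^ k * G.sideL2Sq τ e (jump (normal e) g) := by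
  have := G.len_pos τ
  have := G.sideL2Sq_nonneg τ e (jump (normal e) g)
  unfold jumpTerm
  split_ifs
  · exact le_rfl
  · positivity

theorem IsGraded.len_pow_mul_setIntegral_le {c : ℝ} (hG : G.IsGraded P c) (hτ : τ ∈ P)
    (hτ' : τ' ∈ G.facing P τ e) (k : ℕ) {F : ℝ → ℝ} (hF : ∀ t, 0 ≤ F t) :
    G.len τ ^ k * (∫ t in G.sideIoo τ e ∩ G.sideIoo τ' e, F t) ≤
      max 1 c ^ k * (G.len τ' ^ k * ∫ t in G.sideIoo τ e ∩ G.sideIoo τ' e, F t) := by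
  rcases (G.sideIoo τ e ∩ G.sideIoo τ' e).eq_empty_or_nonempty with hempty | ⟨t, ht, ht'⟩
  · simp [hempty]
  · have hlen := hG.len_le hτ (mem_facing.1 hτ').1 (mem_facing.1 hτ').2 ht ht'
    rw [← mul_assoc, ← mul_pow]
    exact mul_le_mul_of_nonneg_right (pow_le_pow_left₀ (G.len_pos τ).le hlen k)
      (integral_nonneg hF)

theorem HasPieces.jumpTerm_le {c : ℝ} (hg : G.HasPieces P p g) (hP : G.IsPartition Q P)
    (hG : G.IsGraded P c) (hτ : τ ∈ P) (k : ℕ) (e : Side) :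
    G.jumpTerm Q g k τ e ≤ 2 * (G.len τ ^ k * G.sideL2Sq τ e (polyFun (p τ))) +
      2 * (max 1 c ^ k * ∑ τ' ∈ G.facing P τ e, G.len τ' ^ k *
        ∫ t in G.sideIoo τ e ∩ G.sideIoo τ' e, polyFun (p τ') (G.sidePoint τ' e.opp t) ^ 2) := by
  have hl := G.len_pos τ
  let I (τ' : Cell) : ℝ := ∫ t in G.sideIoo τ e ∩ G.sideIoo τ' e,
    polyFun (p τ') (G.sidePoint τ' e.opp t) ^ 2
  have houter : G.len τ ^ k * ∑ τ' ∈ G.facing P τ e, I τ' ≤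
      max 1 c ^ k * ∑ τ' ∈ G.facing P τ e, G.len τ' ^ k * I τ' := by
    rw [Finset.mul_sum, Finset.mul_sum]
    exact Finset.sum_le_sum fun τ' hτ' =>
      hG.len_pow_mul_setIntegral_le hτ hτ' k fun _ => sq_nonneg _
  by_cases he : G.side τ e ⊆ G.domain Q
  · calc G.jumpTerm Q g k τ e
        ≤ G.len τ ^ k * G.sideL2Sq τ e (jump (normal e) g) := jumpTerm_le_len_pow_mul_sideL2Sq k τ e
      _ ≤ G.len τ ^ k * (2 * G.sideL2Sq τ e (polyFun (p τ)) +
          2 * ∑ τ' ∈ G.facing P τ e, I τ') := by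
          gcongr
          exact hg.sideL2Sq_jump_le hP hτ he
      _ ≤ _ := by linarith
  · have hinner := G.sideL2Sq_nonneg τ e (polyFun (p τ))
    have : 0 ≤ ∑ τ' ∈ G.facing P τ e, I τ' :=
      Finset.sum_nonneg fun τ' _ => integral_nonneg fun _ => sq_nonneg _
    have hnonneg := (by positivity : 0 ≤ G.len τ ^ k * ∑ τ' ∈ G.facing P τ e, I τ').trans houter
    rw [jumpTerm, if_neg he]
    positivity

/-- Each cell sees disjoint parts of its side `e.opp` from the cells that it faces, so summing
the outer traces over all cells counts the trace of each cell at most once. -/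
theorem IsPartition.sum_sum_facing_le (hP : G.IsPartition Q P)
    (p : Cell → MvPolynomial (Fin 2) ℝ) (k : ℕ) (e : Side) :
    ∑ τ ∈ P, ∑ τ' ∈ G.facing P τ e, G.len τ' ^ k *
        ∫ t in G.sideIoo τ e ∩ G.sideIoo τ' e, polyFun (p τ') (G.sidePoint τ' e.opp t) ^ 2 ≤
      ∑ τ ∈ P, G.len τ ^ k * G.sideL2Sq τ e.opp (polyFun (p τ)) := by
  rw [Finset.sum_comm' fun _ _ => mem_facing_opp_comm]
  refine Finset.sum_le_sum fun τ' _ => ?_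
  have hl := G.len_pos τ'
  rw [← Finset.mul_sum, sideL2Sq_eq_setIntegral]
  gcongr
  exact sum_setIntegral_le _ (fun _ _ => measurableSet_Ioo.inter measurableSet_Ioo)
    ((hP.pairwiseDisjoint_facing τ' e.opp).mono_on fun _ _ => inter_subset_left)
    (fun _ _ => inter_subset_right) (fun _ => sq_nonneg _)
    (memLp_polyFun_sidePoint (p τ') τ' e.opp).integrable_sq

theorem HasPieces.sum_jumpTerm_le {c : ℝ} (hg : G.HasPieces P p g) (hP : G.IsPartition Q P)
    (hG : G.IsGraded P c) {k : ℕ} {E : Cell → ℝ}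
    (hE : ∀ τ ∈ P, ∀ e, G.len τ ^ k * G.sideL2Sq τ e (polyFun (p τ)) ≤ E τ) (e : Side) :
    ∑ τ ∈ P, G.jumpTerm Q g k τ e ≤ 2 * (1 + max 1 c ^ k) * ∑ τ ∈ P, E τ := by
  have : 0 ≤ max 1 c := zero_le_one.trans (le_max_left _ _)
  calc ∑ τ ∈ P, G.jumpTerm Q g k τ e
      ≤ 2 * (∑ τ ∈ P, G.len τ ^ k * G.sideL2Sq τ e (polyFun (p τ))) +
        2 * (max 1 c ^ k * ∑ τ ∈ P, ∑ τ' ∈ G.facing P τ e, G.len τ' ^ k *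
          ∫ t in G.sideIoo τ e ∩ G.sideIoo τ' e,
            polyFun (p τ') (G.sidePoint τ' e.opp t) ^ 2) := by
        simp only [Finset.mul_sum (s := P), ← Finset.sum_add_distrib]
        exact Finset.sum_le_sum fun τ hτ => hg.jumpTerm_le hP hG hτ k e
    _ ≤ 2 * (∑ τ ∈ P, E τ) + 2 * (max 1 c ^ k * ∑ τ ∈ P, E τ) := by
        gcongr 2 * ?_ + 2 * (max 1 c ^ k * ?_)
        · exact Finset.sum_le_sum fun τ hτ => hE τ hτ e
        · exact (hP.sum_sum_facing_le p k e).trans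
            (Finset.sum_le_sum fun τ hτ => hE τ hτ e.opp)
    _ = 2 * (1 + max 1 c ^ k) * ∑ τ ∈ P, E τ := by ring

theorem jumpTerm_le_young {q : Cell → MvPolynomial (Fin 2) ℝ} {h d : Plane → ℝ}
    (hP : G.IsPartition Q P) (hg : G.HasPieces P p g) (hh : G.HasPieces P q h)
    (hd : G.HasPieces P (p - q) d) (hτ : τ ∈ P) (k : ℕ) (e : Side) {δ : ℝ} (hδ : 0 < δ) :
    G.jumpTerm Q h k τ e ≤
      (1 + δ) * G.jumpTerm Q g k τ e + (1 + 1 / δ) * G.jumpTerm Q d k τ e := by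
  unfold jumpTerm
  split_ifs with he
  · have hl := G.len_pos τ
    have hsub : ∀ᵐ t ∂(volume.restrict (G.sideIoo τ e)), jump (normal e) h (G.sidePoint τ e t) =
        jump (normal e) g (G.sidePoint τ e t) - jump (normal e) d (G.sidePoint τ e t) := by
      filter_upwards [hP.ae_exists_neighbour hτ he, ae_restrict_mem measurableSet_Ioo]
        with t ⟨τ', hτ', ht', hz⟩ ht
      simp only [hg.jump_sidePoint hτ hτ' hz ht ht', hh.jump_sidePoint hτ hτ' hz ht ht',
        hd.jump_sidePoint hτ hτ' hz ht ht', Pi.sub_apply, map_sub]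
      ring
    have hyoung := integral_sq_le_young hsub (hg.memLp_jump hP hτ he) (hd.memLp_jump hP hτ he) hδ
    simp only [← sideL2Sq_eq_setIntegral] at hyoung
    calc _ ≤ G.len τ ^ k * ((1 + δ) * G.sideL2Sq τ e (jump (normal e) g) +
          (1 + 1 / δ) * G.sideL2Sq τ e (jump (normal e) d)) := by gcongr
      _ = _ := by ring
  · simp

end JumpTerms

section JumpTermsOfDescendants

variable {Ps S : Finset Cell} {ρ : ℝ} {k : ℕ}

theorem pow_le_mul_pow {a b : ℝ} (ha : 0 ≤ a) (hb : 0 ≤ b) (hρ0 : 0 ≤ ρ) (hρ1 : ρ ≤ 1)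
    (h : a ≤ ρ * b) (hk : k ≠ 0) : a ^ k ≤ ρ * b ^ k :=
  calc a ^ k ≤ ρ ^ k * b ^ k := mul_pow ρ b k ▸ pow_le_pow_left₀ ha h k
    _ ≤ ρ * b ^ k := by
        gcongr
        exact pow_le_of_le_one hρ0 hρ1 hk

theorem side_subset_cell (h : G.cell τ' ⊆ G.cell τ) (hne : G.sideCoord τ' e ≠ G.sideCoord τ e) :
    G.side τ' e ⊆ G.cell τ := by
  rintro _ ⟨t, ht, rfl⟩
  have hc := G.corner_bounds_of_cell_subset h e.1
  have hl := G.len_pos τ'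
  rw [sidePoint_eq_pt, pt_mem_cell]
  refine ⟨?_, G.sideIoo_subset_of_cell_subset h e ht⟩
  unfold sideCoord at hne ⊢
  cases hb : e.2
  · simp only [hb, Bool.false_eq_true, ↓reduceIte, add_zero] at hne ⊢
    exact ⟨lt_of_le_of_ne hc.1 hne.symm, by linarith⟩
  · simp only [hb, ↓reduceIte] at hne ⊢
    exact ⟨by linarith, lt_of_le_of_ne hc.2 hne⟩

theorem HasPieces.jumpTerm_eq_zero (hg : G.HasPieces P p g) (hτ : τ ∈ P)
    (h : G.side τ' e ⊆ G.cell τ) : G.jumpTerm Q g k τ' e = 0 := by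
  have hzero : G.sideL2Sq τ' e (jump (normal e) g) = 0 := by
    rw [sideL2Sq_eq_setIntegral]
    refine setIntegral_eq_zero_of_forall_eq_zero fun t ht => ?_
    rw [jump_eq_zero_of_continuousAt (hg.continuousAt hτ (h ⟨t, ht, rfl⟩)), sq, mul_zero]
  simp [jumpTerm, hzero]

theorem HasPieces.sum_jumpTerm_aligned_le (hg : G.HasPieces P p g) (hP : G.IsPartition Q P)
    (hPs : G.IsPartition Q Ps) (hτ : τ ∈ P) (he : G.side τ e ⊆ G.domain Q) (hS : S ⊆ Ps)
    (hρ0 : 0 ≤ ρ) (hρ1 : ρ ≤ 1)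
    (hsub : ∀ τs ∈ S, G.cell τs ⊆ G.cell τ ∧ G.len τs ≤ ρ * G.len τ)
    (hz : ∀ τs ∈ S, G.sideCoord τs e = G.sideCoord τ e) (hk : k ≠ 0) :
    ∑ τs ∈ S, G.jumpTerm Q g k τs e ≤ ρ * G.jumpTerm Q g k τ e := by
  have hl := G.len_pos τ
  let J (t : ℝ) : ℝ := jump (normal e) g (G.sidePoint τ e t) ^ 2
  calc ∑ τs ∈ S, G.jumpTerm Q g k τs e
      ≤ ∑ τs ∈ S, ρ * G.len τ ^ k * ∫ t in G.sideIoo τs e, J t := by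
        refine Finset.sum_le_sum fun τs hτs => ?_
        refine (jumpTerm_le_len_pow_mul_sideL2Sq k τs e).trans ?_
        simp only [sideL2Sq_eq_setIntegral, sidePoint_eq_pt, hz τs hτs]
        exact mul_le_mul_of_nonneg_right
          (pow_le_mul_pow (G.len_pos τs).le hl.le hρ0 hρ1 (hsub τs hτs).2 hk)
          (integral_nonneg fun _ => sq_nonneg _)
    _ ≤ ρ * G.len τ ^ k * ∫ t in G.sideIoo τ e, J t := by
        rw [← Finset.mul_sum]
        gcongr
        exact sum_setIntegral_le _ (fun _ _ => measurableSet_Ioo)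
          (hPs.pairwiseDisjoint_sideIoo hS hz)
          (fun τs hτs => G.sideIoo_subset_of_cell_subset (hsub τs hτs).1 e)
          (fun _ => sq_nonneg _) (hg.memLp_jump hP hτ he).integrable_sq
    _ = ρ * G.jumpTerm Q g k τ e := by
        rw [jumpTerm, if_pos he, sideL2Sq_eq_setIntegral, mul_assoc]

theorem HasPieces.sum_jumpTerm_descendants_le (hg : G.HasPieces P p g) (hP : G.IsPartition Q P)
    (hPs : G.IsPartition Q Ps) (hτ : τ ∈ P) (hS : S ⊆ Ps) (hρ0 : 0 ≤ ρ) (hρ1 : ρ ≤ 1)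
    (hsub : ∀ τs ∈ S, G.cell τs ⊆ G.cell τ ∧ G.len τs ≤ ρ * G.len τ) (hk : k ≠ 0) (e : Side) :
    ∑ τs ∈ S, G.jumpTerm Q g k τs e ≤ ρ * G.jumpTerm Q g k τ e := by
  classical
  let A := S.filter fun τs => G.sideCoord τs e = G.sideCoord τ e
  have hA : ∑ τs ∈ S, G.jumpTerm Q g k τs e = ∑ τs ∈ A, G.jumpTerm Q g k τs e := by
    refine (Finset.sum_filter_of_ne fun τs hτs hne => ?_).symm
    by_contra hz
    exact hne (hg.jumpTerm_eq_zero hτ (side_subset_cell (hsub τs hτs).1 hz))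
  rw [hA]
  by_cases he : G.side τ e ⊆ G.domain Q
  · exact hg.sum_jumpTerm_aligned_le hP hPs hτ he ((Finset.filter_subset _ _).trans hS) hρ0 hρ1
      (fun τs hτs => hsub τs (Finset.mem_filter.1 hτs).1)
      (fun τs hτs => (Finset.mem_filter.1 hτs).2) hk
  · have hboundary (τs : Cell) (hτs : τs ∈ A) : G.jumpTerm Q g k τs e = 0 :=
      if_neg fun h => he (G.side_subset_domain (hsub τs (Finset.mem_filter.1 hτs).1).1
        (Finset.mem_filter.1 hτs).2 h)
    rw [jumpTerm, if_neg he, mul_zero, Finset.sum_eq_zero hboundary]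

end JumpTermsOfDescendants

end Grid

namespace Grid

variable {G : Grid} {Q : Finset (Fin 2 → ℤ)} {P M Ps S : Finset Cell} {τ : Cell}
  {f g V : Plane → ℝ} {p : Cell → MvPolynomial (Fin 2) ℝ} {δ ρ : ℝ}

section SideIndicators

/-- The contribution of the side `e` of `τ` to the error indicator of a function with
Laplacian `g`: the weighted jumps of `∂g/∂n` and `g` across this side. -/
def sideIndicatorSq (G : Grid) (Q : Finset (Fin 2 → ℤ)) (g : Plane → ℝ) (τ : Cell) (e : Side) : ℝ :=
  G.jumpTerm Q (fun y => fderiv ℝ g y (normal e)) 3 τ e + G.jumpTerm Q g 1 τ e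

theorem HasPieces.sum_sideIndicatorSq_descendants_le (hg : G.HasPieces P p g)
    (hP : G.IsPartition Q P) (hPs : G.IsPartition Q Ps) (hτ : τ ∈ P) (hS : S ⊆ Ps) (hρ0 : 0 ≤ ρ)
    (hρ1 : ρ ≤ 1) (hsub : ∀ τs ∈ S, G.cell τs ⊆ G.cell τ ∧ G.len τs ≤ ρ * G.len τ) (e : Side) :
    ∑ τs ∈ S, G.sideIndicatorSq Q g τs e ≤ ρ * G.sideIndicatorSq Q g τ e := by
  simp only [sideIndicatorSq, Finset.sum_add_distrib, mul_add]
  exact add_le_add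
    ((hg.fderiv_normal e).sum_jumpTerm_descendants_le hP hPs hτ hS hρ0 hρ1 hsub three_ne_zero e)
    (hg.sum_jumpTerm_descendants_le hP hPs hτ hS hρ0 hρ1 hsub one_ne_zero e)

theorem sideIndicatorSq_le_young {q : Cell → MvPolynomial (Fin 2) ℝ} {h d : Plane → ℝ}
    (hP : G.IsPartition Q P) (hg : G.HasPieces P p g) (hh : G.HasPieces P q h)
    (hd : G.HasPieces P (p - q) d) (hτ : τ ∈ P) (e : Side) (hδ : 0 < δ) :
    G.sideIndicatorSq Q h τ e ≤
      (1 + δ) * G.sideIndicatorSq Q g τ e + (1 + 1 / δ) * G.sideIndicatorSq Q d τ e := by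
  have hlin (a : ℝ) : a • MvPolynomial.pderiv e.1 ∘ (p - q) =
      a • MvPolynomial.pderiv e.1 ∘ p - a • MvPolynomial.pderiv e.1 ∘ q := funext fun τ => by
    simp only [Pi.smul_apply, Pi.sub_apply, Function.comp_apply, map_sub, smul_sub]
  have hnormal := jumpTerm_le_young hP (hg.fderiv_normal e) (hh.fderiv_normal e)
    (hlin _ ▸ hd.fderiv_normal e) hτ 3 e hδ
  have hvalue := jumpTerm_le_young hP hg hh hd hτ 1 e hδ
  unfold sideIndicatorSq
  linarith

theorem exists_sum_sideIndicatorSq_le (r : ℕ) (c : ℝ) : ∃ C, 0 < C ∧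
    ∀ (G : Grid) (Q : Finset (Fin 2 → ℤ)) (P : Finset Cell) (p : Cell → MvPolynomial (Fin 2) ℝ)
      (g : Plane → ℝ), G.IsPartition Q P → G.IsGraded P c → G.HasPieces P p g →
      (∀ τ ∈ P, p τ ∈ MvPolynomial.restrictDegree (Fin 2) ℝ r) → ∀ e : Side,
      ∑ τ ∈ P, G.sideIndicatorSq Q g τ e ≤ C * ∑ τ ∈ P, ∫ x in G.cell τ, polyFun (p τ) x ^ 2 := by
  obtain ⟨K₁, hK₁, trace⟩ := exists_sideL2Sq_le r
  obtain ⟨K₃, hK₃, trace_pderiv⟩ := exists_sideL2Sq_pderiv_le r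
  have : 0 < max 1 c := zero_lt_one.trans_le (le_max_left _ _)
  refine ⟨2 * (1 + max 1 c ^ 3) * K₃ + 2 * (1 + max 1 c ^ 1) * K₁, by positivity,
    fun G Q P p g hP hG hg hp e => ?_⟩
  have hnormal := (hg.fderiv_normal e).sum_jumpTerm_le (k := 3) hP hG (fun τ hτ e' => by
    have hsign : (if e.2 then (1 : ℝ) else -1) ^ 2 = 1 := by split_ifs <;> norm_num
    simp only [Pi.smul_apply, Function.comp_apply, map_smul, sideL2Sq_smul, hsign, one_mul]
    exact trace_pderiv _ (hp τ hτ) G τ e' e.1) e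
  have hvalue := hg.sum_jumpTerm_le (k := 1) hP hG (fun τ hτ e' => by
    rw [pow_one]
    exact trace _ (hp τ hτ) G τ e') e
  rw [← Finset.mul_sum] at hnormal hvalue
  simp only [sideIndicatorSq, Finset.sum_add_distrib]
  linarith

end SideIndicators

section Residuals

theorem HasPieces.memLp_residual (hV : G.HasPieces P p V) (hP : G.IsPartition Q P)
    (hf : MemLp f 2 (volume.restrict (G.domain Q))) (hτ : τ ∈ P) :
    MemLp (fun x => f x - lap (lap V) x) 2 (volume.restrict (G.cell τ)) := by
  have hf' : MemLp f 2 (volume.restrict (G.cell τ)) :=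
    hf.mono_measure (Measure.restrict_mono (hP.cell_subset_domain hτ) le_rfl)
  have hcont := continuous_polyFun (lapPoly (lapPoly (p τ)))
  have hpoly : MemLp (polyFun (lapPoly (lapPoly (p τ)))) 2 (volume.restrict (G.cell τ)) :=
    (memLp_two_iff_integrable_sq hcont.aestronglyMeasurable).2
      (G.integrableOn_cell_of_continuous (hcont.pow 2) τ)
  refine (memLp_congr_ae ?_).2 (hf'.sub hpoly)
  filter_upwards [ae_restrict_mem (G.measurableSet_cell τ)] with x hx
  rw [Pi.sub_apply, hV.lap.lap τ hτ hx]
  rfl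

theorem HasPieces.sum_residual_descendants_le (hV : G.HasPieces P p V) (hP : G.IsPartition Q P)
    (hPs : G.IsPartition Q Ps) (hf : MemLp f 2 (volume.restrict (G.domain Q))) (hτ : τ ∈ P)
    (hS : S ⊆ Ps) (hρ0 : 0 ≤ ρ) (hρ1 : ρ ≤ 1)
    (hsub : ∀ τs ∈ S, G.cell τs ⊆ G.cell τ ∧ G.len τs ≤ ρ * G.len τ) :
    ∑ τs ∈ S, G.len τs ^ 4 * (∫ x in G.cell τs, (f x - lap (lap V) x) ^ 2) ≤
      ρ * (G.len τ ^ 4 * ∫ x in G.cell τ, (f x - lap (lap V) x) ^ 2) := by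
  have hl := G.len_pos τ
  calc ∑ τs ∈ S, G.len τs ^ 4 * (∫ x in G.cell τs, (f x - lap (lap V) x) ^ 2)
      ≤ ∑ τs ∈ S, ρ * G.len τ ^ 4 * ∫ x in G.cell τs, (f x - lap (lap V) x) ^ 2 :=
        Finset.sum_le_sum fun τs hτs => mul_le_mul_of_nonneg_right
          (pow_le_mul_pow (G.len_pos τs).le hl.le hρ0 hρ1 (hsub τs hτs).2 four_ne_zero)
          (integral_nonneg fun _ => sq_nonneg _)
    _ ≤ ρ * G.len τ ^ 4 * ∫ x in G.cell τ, (f x - lap (lap V) x) ^ 2 := by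
        rw [← Finset.mul_sum]
        gcongr
        exact sum_setIntegral_le _ (fun τs _ => G.measurableSet_cell τs)
          (hPs.1.subset (by exact_mod_cast hS)) (fun τs hτs => (hsub τs hτs).1)
          (fun _ => sq_nonneg _) (hV.memLp_residual hP hf hτ).integrable_sq
    _ = ρ * (G.len τ ^ 4 * ∫ x in G.cell τ, (f x - lap (lap V) x) ^ 2) := mul_assoc _ _ _

theorem HasPieces.integral_residual_sq_le_young {q : Cell → MvPolynomial (Fin 2) ℝ}
    {Vs : Plane → ℝ} (hV : G.HasPieces P p V) (hVs : G.HasPieces P q Vs) (hP : G.IsPartition Q P)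
    (hf : MemLp f 2 (volume.restrict (G.domain Q))) (hτ : τ ∈ P) (hδ : 0 < δ) :
    ∫ x in G.cell τ, (f x - lap (lap Vs) x) ^ 2 ≤
      (1 + δ) * (∫ x in G.cell τ, (f x - lap (lap V) x) ^ 2) +
        (1 + 1 / δ) * ∫ x in G.cell τ, ((0 : Plane → ℝ) x - lap (lap (V - Vs)) x) ^ 2 := by
  have hD := hV.sub hVs
  refine integral_sq_le_young ?_ (hV.memLp_residual hP hf hτ)
    (hD.memLp_residual hP MemLp.zero hτ) hδ
  filter_upwards [ae_restrict_mem (G.measurableSet_cell τ)] with x hx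
  simp only [hV.lap.lap τ hτ hx, hVs.lap.lap τ hτ hx, hD.lap.lap τ hτ hx, Function.comp_apply,
    Pi.sub_apply, Pi.zero_apply, map_sub]
  ring

theorem exists_integral_lap_sq_le (r : ℕ) : ∃ K, 0 < K ∧
    ∀ (G : Grid) (P : Finset Cell) (p : Cell → MvPolynomial (Fin 2) ℝ) (g : Plane → ℝ),
      G.HasPieces P p g → (∀ τ ∈ P, p τ ∈ MvPolynomial.restrictDegree (Fin 2) ℝ r) → ∀ τ ∈ P,
      G.len τ ^ 4 * (∫ x in G.cell τ, lap g x ^ 2) ≤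
        K * ∫ x in G.cell τ, polyFun (p τ) x ^ 2 := by
  obtain ⟨K, hK, H⟩ := exists_integral_lapPoly_sq_le r
  refine ⟨K, hK, fun G P p g hg hp τ hτ => ?_⟩
  rw [setIntegral_congr_fun (G.measurableSet_cell τ) (hg.lap_sq_eqOn hτ)]
  exact H _ (hp τ hτ) G τ

end Residuals

section Indicators

theorem indicatorSq_eq (f V : Plane → ℝ) (τ : Cell) :
    G.indicatorSq Q f V τ =
      4 * (G.len τ ^ 4 * ∫ x in G.cell τ, (f x - lap (lap V) x) ^ 2) +
        ∑ e, G.sideIndicatorSq Q (lap V) τ e := by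
  have hsqrt : √2 ^ 4 = 4 := by
    rw [show 4 = 2 * 2 from rfl, pow_mul, Real.sq_sqrt zero_le_two]
    norm_num
  simp only [indicatorSq, sideIndicatorSq, jumpTerm, diam_cell, diam_side, pow_one, mul_pow, hsqrt,
    mul_assoc]
  congr 1
  refine Finset.sum_congr rfl fun e _ => ?_
  split_ifs <;> simp

theorem HasPieces.sum_indicatorSq_descendants_le (hV : G.HasPieces P p V) (hP : G.IsPartition Q P)
    (hPs : G.IsPartition Q Ps) (hf : MemLp f 2 (volume.restrict (G.domain Q))) (hτ : τ ∈ P)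
    (hS : S ⊆ Ps) (hρ0 : 0 ≤ ρ) (hρ1 : ρ ≤ 1)
    (hsub : ∀ τs ∈ S, G.cell τs ⊆ G.cell τ ∧ G.len τs ≤ ρ * G.len τ) :
    ∑ τs ∈ S, G.indicatorSq Q f V τs ≤ ρ * G.indicatorSq Q f V τ := by
  have hresidual := hV.sum_residual_descendants_le hP hPs hf hτ hS hρ0 hρ1 hsub
  have hsides := Finset.sum_le_sum fun e (_ : e ∈ Finset.univ) =>
    hV.lap.sum_sideIndicatorSq_descendants_le hP hPs hτ hS hρ0 hρ1 hsub e
  rw [Finset.sum_comm, ← Finset.mul_sum] at hsides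
  simp only [indicatorSq_eq, Finset.sum_add_distrib, ← Finset.mul_sum]
  linarith

theorem HasPieces.indicatorSq_le_young {q : Cell → MvPolynomial (Fin 2) ℝ} {Vs : Plane → ℝ}
    (hV : G.HasPieces P p V) (hVs : G.HasPieces P q Vs) (hP : G.IsPartition Q P)
    (hf : MemLp f 2 (volume.restrict (G.domain Q))) (hτ : τ ∈ P) (hδ : 0 < δ) :
    G.indicatorSq Q f Vs τ ≤
      (1 + δ) * G.indicatorSq Q f V τ + (1 + 1 / δ) * G.indicatorSq Q 0 (V - Vs) τ := by
  have hl := G.len_pos τ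
  have hpieces : lapPoly ∘ (p - q) = lapPoly ∘ p - lapPoly ∘ q :=
    funext fun _ => map_sub lapPoly _ _
  have hresidual := mul_le_mul_of_nonneg_left
    (hV.integral_residual_sq_le_young hVs hP hf hτ hδ) (by positivity : 0 ≤ 4 * G.len τ ^ 4)
  have hsides := Finset.sum_le_sum fun e (_ : e ∈ Finset.univ) =>
    sideIndicatorSq_le_young hP hV.lap hVs.lap (hpieces ▸ (hV.sub hVs).lap) hτ e hδ
  rw [Finset.sum_add_distrib, ← Finset.mul_sum, ← Finset.mul_sum] at hsides
  simp only [indicatorSq_eq]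
  linarith

theorem HasPieces.estimatorSq_le_young {q : Cell → MvPolynomial (Fin 2) ℝ} {Vs : Plane → ℝ}
    (hV : G.HasPieces P p V) (hVs : G.HasPieces P q Vs) (hP : G.IsPartition Q P)
    (hf : MemLp f 2 (volume.restrict (G.domain Q))) (hδ : 0 < δ) :
    G.estimatorSq Q f Vs P ≤
      (1 + δ) * G.estimatorSq Q f V P + (1 + 1 / δ) * G.estimatorSq Q 0 (V - Vs) P := by
  unfold estimatorSq
  rw [Finset.mul_sum, Finset.mul_sum, ← Finset.sum_add_distrib]
  exact Finset.sum_le_sum fun τ hτ => hV.indicatorSq_le_young hVs hP hf hτ hδ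

end Indicators

section Refinement

open Classical in
/-- The cells of `Ps` that are contained in `τ`. -/
def descendants (G : Grid) (Ps : Finset Cell) (τ : Cell) : Finset Cell :=
  Ps.filter fun τs => G.cell τs ⊆ G.cell τ

theorem mem_descendants {τs : Cell} :
    τs ∈ G.descendants Ps τ ↔ τs ∈ Ps ∧ G.cell τs ⊆ G.cell τ := by
  simp [descendants]

theorem IsRefinement.sum_descendants (hR : G.IsRefinement P M Ps) (hP : G.IsPartition Q P)
    (F : Cell → ℝ) : ∑ τ ∈ P, ∑ τs ∈ G.descendants Ps τ, F τs = ∑ τs ∈ Ps, F τs := by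
  classical
  rw [← Finset.sum_biUnion fun τ hτ τ' hτ' hne => Finset.disjoint_left.2 fun τs h h' => hne <| by
    obtain ⟨x, hx⟩ := G.nonempty_cell τs
    exact hP.eq_of_mem_cell hτ hτ' ((mem_descendants.1 h).2 hx) ((mem_descendants.1 h').2 hx)]
  refine Finset.sum_congr (Finset.ext fun τs => ?_) fun _ _ => rfl
  simp only [Finset.mem_biUnion, mem_descendants]
  exact ⟨fun ⟨_, _, h, _⟩ => h, fun h => (hR.1 τs h).imp fun τ hτ => ⟨hτ.1, h, hτ.2⟩⟩

theorem HasPieces.estimatorSq_refinement_le (hV : G.HasPieces P p V) (hP : G.IsPartition Q P)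
    (hPs : G.IsPartition Q Ps) (hf : MemLp f 2 (volume.restrict (G.domain Q))) (hM : M ⊆ P)
    (hR : G.IsRefinement P M Ps) :
    G.estimatorSq Q f V Ps ≤ G.estimatorSq Q f V P - 1 / 2 * G.estimatorSq Q f V M := by
  classical
  have hcell (τ : Cell) (hτ : τ ∈ P) : ∑ τs ∈ G.descendants Ps τ, G.indicatorSq Q f V τs ≤
      (if τ ∈ M then 1 / 2 else 1) * G.indicatorSq Q f V τ := by
    refine hV.sum_indicatorSq_descendants_le hP hPs hf hτ (fun _ h => (mem_descendants.1 h).1)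
      (by split_ifs <;> norm_num) (by split_ifs <;> norm_num) fun τs hτs => ?_
    obtain ⟨hmem, hsub⟩ := mem_descendants.1 hτs
    refine ⟨hsub, ?_⟩
    split_ifs with hmarked
    · exact G.len_le_half_of_cell_subset hsub fun h => hR.2 τ hmarked (h ▸ hmem)
    · rw [one_mul]
      exact G.len_le_of_cell_subset hsub
  calc G.estimatorSq Q f V Ps
      = ∑ τ ∈ P, ∑ τs ∈ G.descendants Ps τ, G.indicatorSq Q f V τs :=
        (hR.sum_descendants hP _).symm
    _ ≤ ∑ τ ∈ P, (if τ ∈ M then 1 / 2 else 1) * G.indicatorSq Q f V τ := Finset.sum_le_sum hcell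
    _ = ∑ τ ∈ P, (G.indicatorSq Q f V τ -
        1 / 2 * if τ ∈ M then G.indicatorSq Q f V τ else 0) :=
        Finset.sum_congr rfl fun τ _ => by split_ifs <;> ring
    _ = G.estimatorSq Q f V P - 1 / 2 * G.estimatorSq Q f V M := by
        rw [Finset.sum_sub_distrib, ← Finset.mul_sum, ← Finset.sum_filter,
          Finset.filter_mem_eq_inter, Finset.inter_eq_right.2 hM]
        rfl

end Refinement

section Energy

theorem cell_ae_eq_closedCell (τ : Cell) : G.cell τ =ᵐ[volume] G.closedCell τ := by
  have hopen : (fun z : ℝ × ℝ => pt 0 z.1 z.2) ⁻¹' G.cell τ =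
      Ioo (G.corner τ 0) (G.corner τ 0 + G.len τ) ×ˢ
        Ioo (G.corner τ (1 - 0)) (G.corner τ (1 - 0) + G.len τ) :=
    Set.ext fun z => G.pt_mem_cell
  have hclosed : (fun z : ℝ × ℝ => pt 0 z.1 z.2) ⁻¹' G.closedCell τ =
      Icc (G.corner τ 0) (G.corner τ 0 + G.len τ) ×ˢ
        Icc (G.corner τ (1 - 0)) (G.corner τ (1 - 0) + G.len τ) :=
    Set.ext fun z => G.pt_mem_closedCell
  have hvolume : volume (G.closedCell τ) = volume (G.cell τ) := by
    rw [← (measurePreserving_pt 0).measure_preimage_emb (measurableEmbedding_pt 0),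
      ← (measurePreserving_pt 0).measure_preimage_emb (measurableEmbedding_pt 0), hopen, hclosed,
      Measure.volume_eq_prod, Measure.prod_prod, Measure.prod_prod]
    simp only [Real.volume_Icc, Real.volume_Ioo]
  exact ae_eq_of_subset_of_measure_ge (G.cell_subset_closedCell τ) hvolume.le
    (G.measurableSet_cell τ).nullMeasurableSet (G.isCompact_closedCell τ).measure_ne_top

theorem HasPieces.sum_integral_lapPoly_sq_le_energySq (hV : G.HasPieces P p V)
    (hP : G.IsPartition Q P) :
    ∑ τ ∈ P, ∫ x in G.cell τ, polyFun (lapPoly (p τ)) x ^ 2 ≤ G.energySq Q V := by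
  have hinteg : IntegrableOn (fun x => lap V x ^ 2) (G.domain Q) := by
    refine IntegrableOn.mono_set ?_ (hP.2 ▸ subset_closure : G.domain Q ⊆ ⋃ τ ∈ P, G.closedCell τ)
    refine integrableOn_finset_iUnion.2 fun τ hτ =>
      IntegrableOn.congr_set_ae ?_ (cell_ae_eq_closedCell τ).symm
    exact (integrableOn_congr_fun (hV.lap_sq_eqOn hτ) (G.measurableSet_cell τ)).2
      (G.integrableOn_cell_of_continuous ((continuous_polyFun _).pow 2) τ)
  calc ∑ τ ∈ P, ∫ x in G.cell τ, polyFun (lapPoly (p τ)) x ^ 2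
      = ∑ τ ∈ P, ∫ x in G.cell τ, lap V x ^ 2 := Finset.sum_congr rfl fun τ hτ =>
        setIntegral_congr_fun (G.measurableSet_cell τ) (hV.lap_sq_eqOn hτ).symm
    _ ≤ G.energySq Q V := sum_setIntegral_le _ (fun τ _ => G.measurableSet_cell τ) hP.1
        (fun τ hτ => hP.cell_subset_domain hτ) (fun _ => sq_nonneg _) hinteg

theorem exists_estimatorSq_zero_le_energySq (r : ℕ) (c : ℝ) : ∃ C, 0 < C ∧
    ∀ (G : Grid) (Q : Finset (Fin 2 → ℤ)) (P : Finset Cell) (p : Cell → MvPolynomial (Fin 2) ℝ)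
      (V : Plane → ℝ), G.IsPartition Q P → G.IsGraded P c → G.HasPieces P p V →
      (∀ τ ∈ P, p τ ∈ MvPolynomial.restrictDegree (Fin 2) ℝ r) →
      G.estimatorSq Q 0 V P ≤ C * G.energySq Q V := by
  obtain ⟨K, hK, inverse⟩ := exists_integral_lap_sq_le r
  obtain ⟨C, hC, sides⟩ := exists_sum_sideIndicatorSq_le r c
  refine ⟨4 * K + 4 * C, by positivity, fun G Q P p V hP hG hV hp => ?_⟩
  have hdeg (τ : Cell) (hτ : τ ∈ P) : lapPoly (p τ) ∈ MvPolynomial.restrictDegree (Fin 2) ℝ r :=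
    lapPoly_mem_restrictDegree (hp τ hτ)
  let E : ℝ := ∑ τ ∈ P, ∫ x in G.cell τ, polyFun (lapPoly (p τ)) x ^ 2
  have hresidual : ∑ τ ∈ P, G.len τ ^ 4 * (∫ x in G.cell τ, lap (lap V) x ^ 2) ≤ K * E :=
    Finset.mul_sum P _ K ▸ Finset.sum_le_sum fun τ hτ =>
      inverse G P (lapPoly ∘ p) (lap V) hV.lap hdeg τ hτ
  have hsides : ∑ e, ∑ τ ∈ P, G.sideIndicatorSq Q (lap V) τ e ≤ 4 * (C * E) := by
    refine (Finset.sum_le_card_nsmul _ _ _ fun e _ =>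
      sides G Q P (lapPoly ∘ p) (lap V) hP hG hV.lap hdeg e).trans_eq ?_
    simp [E]
  calc G.estimatorSq Q 0 V P
      = 4 * (∑ τ ∈ P, G.len τ ^ 4 * ∫ x in G.cell τ, lap (lap V) x ^ 2) +
        ∑ e, ∑ τ ∈ P, G.sideIndicatorSq Q (lap V) τ e := by
        simp only [estimatorSq, indicatorSq_eq, Finset.sum_add_distrib, Finset.mul_sum,
          Pi.zero_apply, zero_sub, neg_sq]
        rw [Finset.sum_comm (s := P)]
    _ ≤ (4 * K + 4 * C) * E := by linarith
    _ ≤ (4 * K + 4 * C) * G.energySq Q V := by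
        gcongr
        exact hV.sum_integral_lapPoly_sq_le_energySq hP

end Energy

section PiecewisePolynomials

/-- The space `𝒫ʳ_P(Ω)` of functions that are polynomials of degree at most `r` in each variable
on every cell of `P`. No continuity across the sides is imposed, so on this space `energySq` is the
square of the broken energy norm. -/
def piecewisePolynomials (G : Grid) (r : ℕ) (P : Finset Cell) : Submodule ℝ (Plane → ℝ) where
  carrier := {V | ∀ τ ∈ P, ∃ p ∈ MvPolynomial.restrictDegree (Fin 2) ℝ r,
    EqOn V (polyFun p) (G.cell τ)}
  zero_mem' τ _ := ⟨0, Submodule.zero_mem _, fun x _ => by simp⟩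
  add_mem' hV hW τ hτ := by
    obtain ⟨p, hp, hVp⟩ := hV τ hτ
    obtain ⟨q, hq, hWq⟩ := hW τ hτ
    exact ⟨p + q, Submodule.add_mem _ hp hq, fun x hx => by
      rw [Pi.add_apply, hVp hx, hWq hx, map_add, Pi.add_apply]⟩
  smul_mem' a V hV τ hτ := by
    obtain ⟨p, hp, hVp⟩ := hV τ hτ
    exact ⟨a • p, Submodule.smul_mem _ a hp, fun x hx => by
      rw [Pi.smul_apply, hVp hx, map_smul, Pi.smul_apply]⟩

variable {r : ℕ}

theorem exists_hasPieces (hV : V ∈ G.piecewisePolynomials r P) :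
    ∃ p, G.HasPieces P p V ∧ ∀ τ ∈ P, p τ ∈ MvPolynomial.restrictDegree (Fin 2) ℝ r := by
  have h : ∀ τ ∈ P, ∃ p ∈ MvPolynomial.restrictDegree (Fin 2) ℝ r,
    EqOn V (polyFun p) (G.cell τ) := hV
  choose! p hp hVp using h
  exact ⟨p, hVp, hp⟩

theorem IsRefinement.piecewisePolynomials_le (hR : G.IsRefinement P M Ps) :
    G.piecewisePolynomials r P ≤ G.piecewisePolynomials r Ps := fun V hV τs hτs => by
  obtain ⟨τ, hτ, hsub⟩ := hR.1 τs hτs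
  obtain ⟨p, hp, hVp⟩ := hV τ hτ
  exact ⟨p, hp, hVp.mono hsub⟩

theorem IsSpline.mem_piecewisePolynomials (hV : G.IsSpline Q r P V) :
    V ∈ G.piecewisePolynomials r P := fun τ hτ => by
  obtain ⟨p, hp, hVp⟩ := hV.2 τ hτ
  exact ⟨p, mem_restrictDegree_iff_degreeOf_le.2 hp, fun x hx =>
    (hVp x hx).trans (polyFun_apply p x).symm⟩

theorem span_le_piecewisePolynomials {B : Finset (Plane → ℝ)}
    (hB : ∀ β ∈ B, G.IsSpline Q r P β) :
    Submodule.span ℝ (B : Set (Plane → ℝ)) ≤ G.piecewisePolynomials r P :=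
  Submodule.span_le.2 fun β hβ => (hB β hβ).mem_piecewisePolynomials

end PiecewisePolynomials

end Grid

end SplineAFEM

end

theorem mainTheorem7_general (r : ℕ) (c : ℝ) :
    ∃ C : ℝ, 0 < C ∧
      ∀ (G : SplineAFEM.Grid) (Q : Finset (Fin 2 → ℤ)) (f : SplineAFEM.Plane → ℝ)
        (P M Ps : Finset SplineAFEM.Cell),
        MemLp f 2 (volume.restrict (G.domain Q)) →
        G.IsPartition Q P → G.IsPartition Q Ps → G.IsGraded Ps c →
        M ⊆ P → G.IsRefinement P M Ps →
        ∀ δ : ℝ, 0 < δ →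
        ∀ V ∈ G.piecewisePolynomials r P, ∀ Vs ∈ G.piecewisePolynomials r Ps,
          G.estimatorSq Q f Vs Ps ≤
            (1 + δ) * (G.estimatorSq Q f V P - 1 / 2 * G.estimatorSq Q f V M) +
              C * (1 + 1 / δ) * G.energySq Q (V - Vs) := by
  obtain ⟨C, hC, energy⟩ := SplineAFEM.Grid.exists_estimatorSq_zero_le_energySq r c
  refine ⟨C, hC, fun G Q f P M Ps hf hP hPs hG hM hR δ hδ V hV Vs hVs => ?_⟩
  obtain ⟨p, hp, -⟩ := SplineAFEM.Grid.exists_hasPieces hV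
  obtain ⟨q, hq, -⟩ := SplineAFEM.Grid.exists_hasPieces (hR.piecewisePolynomials_le hV)
  obtain ⟨ps, hps, -⟩ := SplineAFEM.Grid.exists_hasPieces hVs
  obtain ⟨d, hd, hdeg⟩ :=
    SplineAFEM.Grid.exists_hasPieces (Submodule.sub_mem _ (hR.piecewisePolynomials_le hV) hVs)
  calc G.estimatorSq Q f Vs Ps
      ≤ (1 + δ) * G.estimatorSq Q f V Ps + (1 + 1 / δ) * G.estimatorSq Q 0 (V - Vs) Ps :=
        hq.estimatorSq_le_young hps hPs hf hδ
    _ ≤ (1 + δ) * (G.estimatorSq Q f V P - 1 / 2 * G.estimatorSq Q f V M) +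
        (1 + 1 / δ) * (C * G.energySq Q (V - Vs)) := by
        gcongr
        · exact hp.estimatorSq_refinement_le hP hPs hf hM hR
        · exact energy G Q Ps d (V - Vs) hPs hG hd hdeg
    _ = _ := by ring

/-- Estimator error reduction. The constant depends only on the polynomial degree and the shape
regularity constant. `B` and `Bs` are the spline bases on `P` and `Ps`, and the spline spaces are
their spans. -/
theorem mainTheorem7 (r : ℕ) (hr : 2 ≤ r) (cShape : ℝ) (hc : 0 < cShape) :
    ∃ C : ℝ, 0 < C ∧
      ∀ (G : SplineAFEM.Grid) (Q : Finset (Fin 2 → ℤ)) (f : SplineAFEM.Plane → ℝ)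
        (P M Ps : Finset SplineAFEM.Cell) (B Bs : Finset (SplineAFEM.Plane → ℝ)),
        MemLp f 2 (volume.restrict (G.domain Q)) →
        G.IsPartition Q P → (∀ β ∈ B, G.IsSpline Q r P β) → G.ShapeRegular P B cShape →
        G.IsPartition Q Ps → (∀ β ∈ Bs, G.IsSpline Q r Ps β) → G.ShapeRegular Ps Bs cShape →
        M ⊆ P → G.IsRefinement P M Ps →
        ∀ δ : ℝ, 0 < δ →
        ∀ V ∈ Submodule.span ℝ (B : Set (SplineAFEM.Plane → ℝ)),
        ∀ Vs ∈ Submodule.span ℝ (Bs : Set (SplineAFEM.Plane → ℝ)),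
          G.estimatorSq Q f Vs Ps ≤
            (1 + δ) * (G.estimatorSq Q f V P - 1 / 2 * G.estimatorSq Q f V M) +
              C * (1 + 1 / δ) * G.energySq Q (V - Vs) := by
  obtain ⟨C, hC, H⟩ := mainTheorem7_general r cShape
  exact ⟨C, hC, fun G Q f P M Ps B Bs hf hP hB _ hPs hBs hSs hM hR δ hδ V hV Vs hVs =>
    H G Q f P M Ps hf hP hPs hSs.2.1 hM hR δ hδ V
      (SplineAFEM.Grid.span_le_piecewisePolynomials hB hV) Vs
      (SplineAFEM.Grid.span_le_piecewisePolynomials hBs hVs)⟩
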